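/- **Setting.** Let $d\ge 0$, $M\ge 1$, $N=M^d$, let $A,B\in\mathbb R^{d\times d}$ with $AB^{\top}=2\pi I$, and let $\tau,\gamma\in\mathbb R$. Put $\mathbb K=\{k\in\mathbb Z^d:-M/2\le k_i<M/2\}$. For a real grid function $\psi$ on the points $x_i=A(i_1/M,\dots,i_d/M)^{\top}$, $0\le i_a<M$, let $\hat\psi(k)=\frac1N\sum_{i}\psi(x_i)e^{-\mathrm i (Bk)\cdot x_i}$, $k\in\mathbb K$. The discretized Landau–Brazovskii energy of $\Phi=(\Phi(k))_{k\in\mathbb K}$ is $$E(\Phi)=\tfrac12\sum_{k_1+k_2\equiv0}\bigl(1-|Bk_1|^2\bigr)^2\Phi(k_1)\Phi(k_2)+\tfrac{\tau}{2}\sum_{k_1+k_2\equiv0}\Phi(k_1)\Phi(k_2)-\tfrac{\gamma}{3!}\sum_{k_1+k_2+k_3\equiv0}\Phi(k_1)\Phi(k_2)\Phi(k_3)+\tfrac1{4!}\sum_{k_1+\dots+k_4\equiv0}\Phi(k_1)\Phi(k_2)\Phi(k_3)\Phi(k_4),$$ where all $k_i\in\mathbb K$ and $\equiv$ is congruence modulo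 $M$ in each component. Let $X$ be the real vector space of all $v\in\mathbb C^{\mathbb K\setminus\{0\}}$ such that $v$, extended by $0$ at $k=0$ (zero mass), is the vector $\hat\psi$ of a real grid function $\psi$, with the inner product $\langle u,v\rangle=\operatorname{Re}\sum_k\overline{u(k)}v(k)$ and norm $\|\cdot\|$. Let $\bar E:X\to\mathbb R$ be $E$ composed with this extension; $\nabla\bar E$ and $\nabla^2\bar E$ are its gradient and Hessian on $X$. **IMEX-TR outer iteration.** Parameters: $\theta\in(0,1)$, $0<\gamma_C<1<\gamma_E$, $\gamma_\lambda>1$, $0<\underline\mu\le\bar\mu$, $\mu_0\ge\underline\mu$, $0<r_0\le\nu_0$, and an arbitrary $v_0\in X$. For $j=0,1,\dots$ put $g_j=\nabla\bar E(v_j)$, $H_j=\nabla^2\bar E(v_j)$. If $g_j=0$, stop. Otherwise: 1. Let $s_j$ be a global minimizer of $\langle g_j,\delta\rangle+\frac12\langle\delta,H_j\delta\rangle$ over $\|\delta\|\le r_j$, with multiplier $\lambda_j\ge0$: $g_j+(H_j+\lambda_jI)s_j=0$, $\|s_j\|\le r_j$, $\lambda_j(\|s_j\|-r_j)=0$, $H_j+\lambda_jI\succeq0$.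 2. If $j>0$ and $\varrho_{j-1}<\theta$, put $\mu_j=\max\{\mu_{j-1},\lambda_j/\|s_j\|\}$. Put $\varrho_j=(\bar E(v_j)-\bar E(v_j+s_j))/\|s_j\|^3$. 3. If $\varrho_j\ge\theta$ and ($\lambda_j\le\mu_j\|s_j\|$ or $\|s_j\|=\nu_j$), put $v_{j+1}=v_j+s_j$, $\nu_{j+1}=\max\{\nu_j,\gamma_E\|s_j\|\}$, $r_{j+1}=\min\{\nu_{j+1},\max\{r_j,\gamma_E\|s_j\|\}\}$, $\mu_{j+1}=\max\{\mu_j,\lambda_j/\|s_j\|\}$. 4. If $\varrho_j<\theta$, put $v_{j+1}=v_j$, $\nu_{j+1}=\nu_j$ and let CONTRACT (below) give $r_{j+1}$. 5. Otherwise put $v_{j+1}=v_j$, $\nu_{j+1}=\nu_j$, $r_{j+1}=\min\{\nu_{j+1},\lambda_j/\mu_j\}$, $\mu_{j+1}=\mu_j$. CONTRACT: write $s(\lambda)$ for a solution of $(H_j+\lambda I)s=-g_j$. If $\lambda_j<\underline\mu\|s_j\|$, let $\hat\lambda=\lambda_j+(\underline\mu\|g_j\|)^{1/2}$; if $\hat\lambda/\|s(\hat\lambda)\|\le\bar\mu$,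 return $\|s(\hat\lambda)\|$, else return $\|s(\tilde\lambda)\|$ for some $\tilde\lambda\in(\lambda_j,\hat\lambda)$ with $\underline\mu\le\tilde\lambda/\|s(\tilde\lambda)\|\le\bar\mu$. If $\lambda_j\ge\underline\mu\|s_j\|$, let $s=s(\gamma_\lambda\lambda_j)$ and return $\|s\|$ if $\|s\|\ge\gamma_C\|s_j\|$, and $\gamma_C\|s\|$ otherwise. **Theorem.** For every infinite sequence $(v_j)$ generated by this iteration (that is, every run that never meets a point with $g_j=0$), $$\lim_{j\to\infty}\|\nabla\bar E(v_j)\|=0,\qquad \liminf_{j\to\infty}\lambda_{\min}\bigl(\nabla^2\bar E(v_j)\bigr)\ge0,$$ and the distance of $v_j$ to the set $\{w\in X:\nabla\bar E(w)=0,\ \nabla^2\bar E(w)\succeq0\}$ of second-order stationary points tends to $0$. -/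

import Mathlib

open Filter Topology
open scoped Matrix

noncomputable section

/-! ### The discretized Landau–Brazovskii energy -/

namespace LandauBrazovskii

/-- The discrete reciprocal space `{k ∈ ℤ^d : -M/2 ≤ k_i < M/2 for all i}`. -/
def freqSet (d M : ℕ) : Finset (Fin d → ℤ) :=
  Fintype.piFinset fun _ =>
    (Finset.Icc (-(M : ℤ)) (M : ℤ)).filter fun m => -(M : ℤ) ≤ 2 * m ∧ 2 * m < (M : ℤ)

theorem mem_freqSet {d M : ℕ} {k : Fin d → ℤ} :
    k ∈ freqSet d M ↔ ∀ i, -(M : ℝ) / 2 ≤ (k i : ℝ) ∧ (k i : ℝ) < (M : ℝ) / 2 := by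
  simp only [freqSet, Fintype.mem_piFinset, Finset.mem_filter, Finset.mem_Icc]
  refine forall_congr' fun i => ?_
  have h1 : -(M : ℝ) / 2 ≤ (k i : ℝ) ↔ -(M : ℤ) ≤ 2 * k i := by
    rw [div_le_iff₀ (by norm_num : (0 : ℝ) < 2), mul_comm]; exact_mod_cast Iff.rfl
  have h2 : (k i : ℝ) < (M : ℝ) / 2 ↔ 2 * k i < (M : ℤ) := by
    rw [lt_div_iff₀ (by norm_num : (0 : ℝ) < 2), mul_comm]; exact_mod_cast Iff.rfl
  rw [h1, h2]
  omega

/-- The index set of all `N = M^d` Fourier modes. -/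
abbrev Freq (d M : ℕ) : Type := {k : Fin d → ℤ // k ∈ freqSet d M}

/-- The index set of the `N - 1` nonzero Fourier modes. -/
abbrev NzFreq (d M : ℕ) : Type := {k : Freq d M // k.1 ≠ 0}

/-- The physical wave vector `B k`. -/
def waveVec {d : ℕ} (B : Matrix (Fin d) (Fin d) ℝ) (k : Fin d → ℤ) : Fin d → ℝ :=
  B *ᵥ fun i => (k i : ℝ)

/-- The grid point `A (i₁/M, …, i_d/M)ᵀ`. -/
def gridPoint {d M : ℕ} (A : Matrix (Fin d) (Fin d) ℝ) (i : Fin d → Fin M) : Fin d → ℝ :=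
  A *ᵥ fun a => ((i a : ℕ) : ℝ) / (M : ℝ)

/-- The discrete Fourier coefficients `(1/N) ∑_x ψ(x) e^{-i (B k)·x}`, `N = M^d`, of a real grid
function `ψ`. -/
def dft {d M : ℕ} (A B : Matrix (Fin d) (Fin d) ℝ) (ψ : (Fin d → Fin M) → ℝ)
    (k : Freq d M) : ℂ :=
  (1 / ((M : ℂ) ^ d)) * ∑ i : Fin d → Fin M,
    (ψ i : ℂ) * Complex.exp (-Complex.I * ((waveVec B k.1 ⬝ᵥ gridPoint A i : ℝ) : ℂ))

/-- The map `v ↦ Pᵀ v`, `P = [0, I]`, that puts back a vanishing zeroth Fourier mode. -/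
def extendZero {d M : ℕ} (v : NzFreq d M → ℂ) (k : Freq d M) : ℂ :=
  if h : k.1 ≠ 0 then v ⟨k, h⟩ else 0

/-- A sum of wave numbers vanishes on the grid: all its entries are multiples of `M`. -/
abbrev Vanishes (M : ℕ) {d : ℕ} (q : Fin d → ℤ) : Prop := ∀ i, (M : ℤ) ∣ q i

/-- The discretized interaction energy
`G = (1/2) ∑_{k₁+k₂=0} (1 - |B k₁|²)² Φ(k₁) Φ(k₂)`. -/
def interactionEnergy {d M : ℕ} (B : Matrix (Fin d) (Fin d) ℝ) (Φ : Freq d M → ℂ) : ℂ :=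
  1 / 2 * ∑ k₁ : Freq d M, ∑ k₂ : Freq d M,
    if Vanishes M (k₁.1 + k₂.1) then
      (((1 - waveVec B k₁.1 ⬝ᵥ waveVec B k₁.1) ^ 2 : ℝ) : ℂ) * (Φ k₁ * Φ k₂)
    else 0

/-- The discretized bulk energy, with its quadratic, cubic and quartic terms. -/
def bulkEnergy {d M : ℕ} (τ γ : ℝ) (Φ : Freq d M → ℂ) : ℂ :=
  (τ : ℂ) / 2 * (∑ k₁ : Freq d M, ∑ k₂ : Freq d M,
      if Vanishes M (k₁.1 + k₂.1) then Φ k₁ * Φ k₂ else 0)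
  - (γ : ℂ) / 6 * (∑ k₁ : Freq d M, ∑ k₂ : Freq d M, ∑ k₃ : Freq d M,
      if Vanishes M (k₁.1 + k₂.1 + k₃.1) then Φ k₁ * Φ k₂ * Φ k₃ else 0)
  + 1 / 24 * (∑ k₁ : Freq d M, ∑ k₂ : Freq d M, ∑ k₃ : Freq d M, ∑ k₄ : Freq d M,
      if Vanishes M (k₁.1 + k₂.1 + k₃.1 + k₄.1) then Φ k₁ * Φ k₂ * Φ k₃ * Φ k₄ else 0)

theorem dft_add {d M : ℕ} (A B : Matrix (Fin d) (Fin d) ℝ) (ψ φ : (Fin d → Fin M) → ℝ)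
    (k : Freq d M) : dft A B (ψ + φ) k = dft A B ψ k + dft A B φ k := by
  simp [dft, add_mul, Finset.sum_add_distrib, mul_add]

theorem dft_smul {d M : ℕ} (A B : Matrix (Fin d) (Fin d) ℝ) (c : ℝ) (ψ : (Fin d → Fin M) → ℝ)
    (k : Freq d M) : dft A B (c • ψ) k = c * dft A B ψ k := by
  simp only [dft, Pi.smul_apply, smul_eq_mul, Complex.ofReal_mul, Finset.mul_sum]
  exact Finset.sum_congr rfl fun i _ => by ring

/-- The space of the unknowns: the real vector space of all `v ∈ ℂ^{N-1}` for which `Pᵀ v` is the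
vector of discrete Fourier coefficients of a real grid function (necessarily of mean zero), with
the real inner product `Re ∑ conj (u k) * v k`. -/
def coeffSpace (d M : ℕ) (A B : Matrix (Fin d) (Fin d) ℝ) :
    Submodule ℝ (EuclideanSpace ℂ (NzFreq d M)) where
  carrier := {v | ∃ ψ : (Fin d → Fin M) → ℝ, ∀ k, extendZero v.ofLp k = dft A B ψ k}
  add_mem' := by
    rintro u v ⟨ψ, hψ⟩ ⟨φ, hφ⟩
    refine ⟨ψ + φ, fun k => ?_⟩
    rw [dft_add, ← hψ, ← hφ]
    by_cases h : k.1 = 0 <;> simp [extendZero, h]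
  zero_mem' := ⟨0, fun k => by by_cases h : k.1 = 0 <;> simp [extendZero, dft, h]⟩
  smul_mem' := by
    rintro c v ⟨ψ, hψ⟩
    refine ⟨c • ψ, fun k => ?_⟩
    rw [dft_smul, ← hψ]
    by_cases h : k.1 = 0 <;> simp [extendZero, h]

/-- The mass-constrained energy `v ↦ E(Pᵀ v)`, `E = G + F`. On the coefficients of a real grid
function `G` and `F` are real numbers, so that the real part loses nothing. -/
def reducedEnergy {d M : ℕ} (A B : Matrix (Fin d) (Fin d) ℝ) (τ γ : ℝ)
    (v : coeffSpace d M A B) : ℝ :=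
  (interactionEnergy B (extendZero v.1.ofLp) + bulkEnergy τ γ (extendZero v.1.ofLp)).re

end LandauBrazovskii

/-! ### The trust region method -/

namespace TrustRegion

/-- The parameters of the method. -/
structure Params where
  θ : ℝ
  γC : ℝ
  γE : ℝ
  γlam : ℝ
  μlow : ℝ
  μhigh : ℝ
  θ_pos : 0 < θ
  θ_lt_one : θ < 1
  γC_pos : 0 < γC
  γC_lt_one : γC < 1
  one_lt_γE : 1 < γE
  one_lt_γlam : 1 < γlam
  μlow_pos : 0 < μlow
  μlow_le_μhigh : μlow ≤ μhigh

variable {X : Type*} [NormedAddCommGroup X] [InnerProductSpace ℝ X] [CompleteSpace X]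

/-- The Hessian `∇²f(v)`, as an operator. -/
def hess (f : X → ℝ) (v : X) : X →L[ℝ] X := fderiv ℝ (gradient f) v

/-- Second-order stationary points: `∇f(v) = 0` and `∇²f(v) ⪰ 0`. -/
def IsSecondOrderStationary (f : X → ℝ) (v : X) : Prop :=
  gradient f v = 0 ∧ (hess f v).IsPositive

/-- The smallest eigenvalue of a symmetric operator on a finite-dimensional space, as the minimum
of `⟨u, T u⟩` over the unit vectors `u`. -/
def minEigenvalue (T : X →L[ℝ] X) : EReal :=
  ⨅ u : {u : X // ‖u‖ = 1}, ((inner ℝ u.1 (T u.1) : ℝ) : EReal)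

/-- The quadratic model `m(δ) = f(v) + ⟨g, δ⟩ + ⟨δ, H δ⟩ / 2` of `f` at `v`. -/
def model (f : X → ℝ) (v δ : X) : ℝ :=
  f v + inner ℝ (gradient f v) δ + 1 / 2 * inner ℝ δ (hess f v δ)

/-- The optimality conditions of the trust region subproblem at `v` with radius `r`, for the step
`s` and the multiplier `lam`. -/
structure SolvesSubproblem (f : X → ℝ) (v : X) (r : ℝ) (s : X) (lam : ℝ) : Prop where
  lam_nonneg : 0 ≤ lam
  stationary : gradient f v + (hess f v s + lam • s) = 0
  feasible : ‖s‖ ≤ r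
  complementary : lam * (‖s‖ - r) = 0
  psd : (hess f v + lam • ContinuousLinearMap.id ℝ X).IsPositive
  global_min : ∀ δ : X, ‖δ‖ ≤ r → model f v s ≤ model f v δ

/-- `t` solves the linear system `(H + l I) t = -g`, where `g = ∇f(v)` and `H = ∇²f(v)`. -/
def SolvesShifted (f : X → ℝ) (v : X) (l : ℝ) (t : X) : Prop :=
  hess f v t + l • t = -gradient f v

/-- `r'` is a radius that the procedure CONTRACT may return at the point `v`, for the trial step
`s` with multiplier `lam`. -/
def Contract (p : Params) (f : X → ℝ) (v s : X) (lam r' : ℝ) : Prop :=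
  if lam < p.μlow * ‖s‖ then
    ∃ t : X, SolvesShifted f v (lam + √(p.μlow * ‖gradient f v‖)) t ∧
      if (lam + √(p.μlow * ‖gradient f v‖)) / ‖t‖ ≤ p.μhigh then r' = ‖t‖
      else
        ∃ (l : ℝ) (u : X), lam < l ∧ l < lam + √(p.μlow * ‖gradient f v‖) ∧
          SolvesShifted f v l u ∧ p.μlow ≤ l / ‖u‖ ∧ l / ‖u‖ ≤ p.μhigh ∧ r' = ‖u‖
  else
    ∃ t : X, SolvesShifted f v (p.γlam * lam) t ∧
      if p.γC * ‖s‖ ≤ ‖t‖ then r' = ‖t‖ else r' = p.γC * ‖t‖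

/-- The sequences `v` (iterates), `s` (trial steps), `lam` (multipliers), `r` (radii), `ν` (upper
bounds for the radii), `μ` (upper bounds for the ratios `lam / ‖s‖`) and `ϱ` (reduction ratios)
are generated by an infinite run of the method on `f`: the method is not stopped by a tolerance,
and it does not stop by itself, which it does only at a point where the gradient is zero. -/
structure IsRun (p : Params) (f : X → ℝ) (v s : ℕ → X) (lam r ν μ ϱ : ℕ → ℝ) : Prop where
  r_zero_pos : 0 < r 0
  r_zero_le : r 0 ≤ ν 0
  μ_zero : p.μlow ≤ μ 0
  not_stopped : ∀ j, gradient f (v j) ≠ 0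
  subproblem : ∀ j, SolvesSubproblem f (v j) (r j) (s j) (lam j)
  ratio : ∀ j, ϱ j = (f (v j) - f (v j + s j)) / ‖s j‖ ^ 3
  accept : ∀ j, p.θ ≤ ϱ j ∧ (lam j ≤ μ j * ‖s j‖ ∨ ‖s j‖ = ν j) →
    v (j + 1) = v j + s j ∧
    ν (j + 1) = max (ν j) (p.γE * ‖s j‖) ∧
    r (j + 1) = min (ν (j + 1)) (max (r j) (p.γE * ‖s j‖)) ∧
    μ (j + 1) = max (μ j) (lam j / ‖s j‖)
  contract : ∀ j, ϱ j < p.θ →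
    v (j + 1) = v j ∧
    ν (j + 1) = ν j ∧
    Contract p f (v j) (s j) (lam j) (r (j + 1)) ∧
    μ (j + 1) = max (μ j) (lam (j + 1) / ‖s (j + 1)‖)
  expand : ∀ j, p.θ ≤ ϱ j ∧ ¬ (lam j ≤ μ j * ‖s j‖ ∨ ‖s j‖ = ν j) →
    v (j + 1) = v j ∧
    ν (j + 1) = ν j ∧
    r (j + 1) = min (ν (j + 1)) (lam j / μ j) ∧
    μ (j + 1) = μ j

end TrustRegion

end

/-! The argument is for a C³ function on a finite-dimensional space with bounded sublevel sets. The
energy is a polynomial in the coefficients, and its quartic part is 1/24 times the grid mean of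
`ψ^4`, which dominates the other terms; this gives the bounded sublevel sets.

Along a run `f` decreases, so the iterates stay in a compact ball, with uniform bounds on Hessians,
gradients and radii. Taylor's cubic error forces `lam j ≤ C * ‖s j‖` at every contraction.
Consecutive rejections beyond the first are contractions, which eventually multiply `lam` by `γlam`;
hence infinitely many steps are accepted (`frequently_accepted`). Accepted steps tend to zero,
because each lowers `f` by at least `θ * ‖s j‖ ^ 3`.

Suppose that the iterates cluster at a point that is not second-order stationary. Close to it, a
short step has a multiplier above `C * ‖s‖`, either since the gradient is bounded away from zero or
since the Hessian has a direction of negative curvature. Contractions are then impossible while the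
radius is small: it grows by the factor `γE` at each acceptance, or grows by an expansion that the
recorded ratio `μ` keeps small. A geometric series keeps the iterates nearby, so this goes on
forever, although infinitely many acceptances would make the radius unbounded (`false_of_growth`,
`not_mapClusterPt`). All cluster points are thus second-order stationary, and compactness gives the
three limits. -/

namespace TrustRegion

/-! ### Taylor estimate for the quadratic model. -/

section Calculus

variable {X : Type*} [NormedAddCommGroup X] [InnerProductSpace ℝ X] [CompleteSpace X] {f : X → ℝ}

theorem contDiff_gradient (hf : ContDiff ℝ 3 f) : ContDiff ℝ 2 (gradient f) :=
  (InnerProductSpace.toDual ℝ X).symm.contDiff.comp (hf.fderiv_right (m := 2) (by norm_num))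

theorem contDiff_hess (hf : ContDiff ℝ 3 f) : ContDiff ℝ 1 (hess f) :=
  (contDiff_gradient hf).fderiv_right (m := 1) (by norm_num)

theorem hasFDerivAt_gradient (hf : ContDiff ℝ 3 f) (x : X) :
    HasFDerivAt (gradient f) (hess f x) x :=
  ((contDiff_gradient hf).differentiable (by norm_num) x).hasFDerivAt

/-- The cubic error bound for the quadratic model on a ball. -/
theorem exists_le_model_add [FiniteDimensional ℝ X] (hf : ContDiff ℝ 3 f) (ρ : ℝ) :
    ∃ L : ℝ, 0 ≤ L ∧ ∀ v s : X, ‖v‖ ≤ ρ → ‖v + s‖ ≤ ρ →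
      (∀ x y : X, inner ℝ (hess f v x) y = inner ℝ x (hess f v y)) →
      f (v + s) ≤ model f v s + L * ‖s‖ ^ 3 := by
  have hH := contDiff_hess hf
  obtain ⟨L, hL⟩ := (isCompact_closedBall (0 : X) ρ).exists_bound_of_continuousOn
    (hH.continuous_fderiv (by norm_num)).continuousOn
  refine ⟨max L 0, le_max_right _ _, fun v s hv hvs hsymm => ?_⟩
  set K : ℝ := max L 0
  have hK : 0 ≤ K := le_max_right _ _
  have hsub : segment ℝ v (v + s) ⊆ Metric.closedBall (0 : X) ρ :=
    (convex_closedBall _ _).segment_subset (by simpa using hv) (by simpa using hvs)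
  have hconv : Convex ℝ (segment ℝ v (v + s)) := convex_segment _ _
  have hdist : ∀ x ∈ segment ℝ v (v + s), ‖x - v‖ ≤ ‖s‖ := by
    intro x hx
    obtain ⟨t, ⟨ht0, ht1⟩, rfl⟩ := (segment_eq_image' ℝ v (v + s)).subset hx
    simp only [add_sub_cancel_left, norm_smul, Real.norm_eq_abs, abs_of_nonneg ht0]
    nlinarith [norm_nonneg s]
  have hvmem := left_mem_segment ℝ v (v + s)
  have h1 : ∀ x ∈ segment ℝ v (v + s), ‖hess f x - hess f v‖ ≤ K * ‖s‖ := by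
    intro x hx
    have := hconv.norm_image_sub_le_of_norm_fderiv_le (𝕜 := ℝ) (f := hess f) (C := K)
      (fun y _ => hH.differentiable (by norm_num) y)
      (fun y hy => (hL y (hsub hy)).trans (le_max_left _ _)) hvmem hx
    exact this.trans (mul_le_mul_of_nonneg_left (hdist x hx) hK)
  have h2 : ∀ x ∈ segment ℝ v (v + s),
      ‖gradient f x - gradient f v - hess f v (x - v)‖ ≤ K * ‖s‖ * ‖s‖ := by
    intro x hx
    have := hconv.norm_image_sub_le_of_norm_hasFDerivWithin_le' (𝕜 := ℝ) (f := gradient f)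
      (fun y _ => (hasFDerivAt_gradient hf y).hasFDerivWithinAt) h1 hvmem hx
    exact this.trans (mul_le_mul_of_nonneg_left (hdist x hx) (by positivity))
  -- Third use of the mean value inequality: with the quadratic part removed, the derivative of `q`
  -- stays within `K * ‖s‖ ^ 2` of the constant functional given by the gradient at `v`.
  let q : X → ℝ := fun x => f x - 1 / 2 * inner ℝ (x - v) (hess f v (x - v))
  have hq : ∀ x, HasFDerivAt q (fderiv ℝ f x - innerSL ℝ (hess f v (x - v))) x := by
    intro x
    have hd : HasFDerivAt (fun x => x - v) (ContinuousLinearMap.id ℝ X) x :=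
      (hasFDerivAt_id x).sub_const v
    have hd' : HasFDerivAt (fun x => hess f v (x - v)) (hess f v) x :=
      (hess f v).hasFDerivAt.comp x hd
    refine ((hf.differentiable (by norm_num) x).hasFDerivAt.sub
      ((hd.inner ℝ hd').const_mul (1 / 2))).congr_fderiv ?_
    ext y
    simp only [sub_apply, smul_apply, innerSL_apply_apply,
      ContinuousLinearMap.comp_apply, ContinuousLinearMap.prod_apply, fderivInnerCLM_apply,
      ContinuousLinearMap.id_apply, smul_eq_mul]
    rw [← hsymm, real_inner_comm (hess f v (x - v)) y]
    ring
  have h3 : ∀ x ∈ segment ℝ v (v + s),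
      ‖(fderiv ℝ f x - innerSL ℝ (hess f v (x - v))) - innerSL ℝ (gradient f v)‖
        ≤ K * ‖s‖ * ‖s‖ := by
    intro x hx
    refine le_of_eq_of_le ?_ (h2 x hx)
    rw [← innerSL_apply_norm (𝕜 := ℝ) (gradient f x - gradient f v - hess f v (x - v))]
    congr 1
    ext y
    simp only [sub_apply, innerSL_apply_apply, inner_sub_left]
    rw [← toDual_gradient, InnerProductSpace.toDual_apply_apply]
    ring
  have h4 := hconv.norm_image_sub_le_of_norm_hasFDerivWithin_le' (𝕜 := ℝ) (f := q)
      (fun y _ => (hq y).hasFDerivWithinAt) h3 hvmem (right_mem_segment ℝ v (v + s))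
  have h5 := (le_abs_self _).trans h4
  simp only [q, add_sub_cancel_left, sub_self, map_zero, inner_zero_left, innerSL_apply_apply] at h5
  simp only [model]
  nlinarith

end Calculus

/-! ### Solutions of the shifted linear systems. -/

section Shifted

variable {X : Type*} [NormedAddCommGroup X] [InnerProductSpace ℝ X]

/-- The solutions of `(H + l I) t = -g` become strictly shorter when the shift grows. -/
theorem norm_lt_of_shift_lt {H : X →L[ℝ] X} {g s t : X} {l' l : ℝ}
    (hpos : (H + l' • ContinuousLinearMap.id ℝ X).IsPositive)
    (hs : H s + l' • s = -g) (ht : H t + l • t = -g) (hg : g ≠ 0) (hl : l' < l) :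
    ‖t‖ < ‖s‖ := by
  have h0 := hpos.inner_nonneg_left (s - t)
  have h1 : (H + l' • ContinuousLinearMap.id ℝ X) (s - t) = (l - l') • t := by
    simp only [add_apply, smul_apply,
      ContinuousLinearMap.id_apply, map_sub, sub_smul]
    have : H s = -g - l' • s := by rw [← hs]; abel
    have h' : H t = -g - l • t := by rw [← ht]; abel
    rw [this, h']; abel
  rw [h1, real_inner_smul_left] at h0
  have h2 : 0 ≤ inner ℝ t (s - t) := nonneg_of_mul_nonneg_right h0 (sub_pos.2 hl)
  have ht0 : t ≠ 0 := by
    rintro rfl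
    simp at ht
    exact hg ht
  have htp : 0 < ‖t‖ := norm_pos_iff.2 ht0
  -- Positivity has made the cross term nonnegative, so strictness only needs `s ≠ t`.
  have h3 : ‖s‖ ^ 2 = ‖t‖ ^ 2 + 2 * inner ℝ t (s - t) + ‖s - t‖ ^ 2 := by
    rw [← norm_add_sq_real]; simp
  rcases eq_or_ne s t with rfl | hne
  · exfalso
    have : l' • s = l • s := by
      have := hs.trans ht.symm
      exact add_left_cancel this
    exact hl.ne (smul_left_injective ℝ ht0 this)
  · have : 0 < ‖s - t‖ := norm_pos_iff.2 (sub_ne_zero.2 hne)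
    exact lt_of_pow_lt_pow_left₀ 2 (norm_nonneg _) (by nlinarith)

theorem norm_le_of_shifted {H : X →L[ℝ] X} {g t : X} {l K : ℝ} (hH : ‖H‖ ≤ K) (hl : 0 ≤ l)
    (ht : H t + l • t = -g) : ‖g‖ ≤ (K + l) * ‖t‖ := by
  rw [← norm_neg, ← ht]
  refine (norm_add_le _ _).trans ?_
  rw [norm_smul, Real.norm_eq_abs, abs_of_nonneg hl, add_mul]
  gcongr
  exact H.le_of_opNorm_le hH t

theorem mul_norm_le_of_shifted {H : X →L[ℝ] X} {g t : X} {l K : ℝ} (hH : ‖H‖ ≤ K) (hl : 0 ≤ l)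
    (ht : H t + l • t = -g) : l * ‖t‖ ≤ ‖g‖ + K * ‖t‖ := by
  have : l • t = -g - H t := by rw [← ht]; abel
  have h := congrArg norm this
  rw [norm_smul, Real.norm_eq_abs, abs_of_nonneg hl] at h
  rw [h]
  refine (norm_sub_le _ _).trans ?_
  rw [norm_neg]
  gcongr
  exact H.le_of_opNorm_le hH t

theorem sub_mul_norm_le_of_shifted {H : X →L[ℝ] X} {g t : X} {l l' : ℝ}
    (hpos : (H + l' • ContinuousLinearMap.id ℝ X).IsPositive)
    (ht : H t + l • t = -g) : (l - l') * ‖t‖ ≤ ‖g‖ := by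
  rcases (norm_nonneg t).eq_or_lt with h | h
  · rw [← h]; simp
  have h0 := hpos.inner_nonneg_left t
  have h1 : (H + l' • ContinuousLinearMap.id ℝ X) t = -g - (l - l') • t := by
    rw [← ht]
    simp only [add_apply, smul_apply,
      ContinuousLinearMap.id_apply, sub_smul]
    abel
  rw [h1, inner_sub_left, real_inner_smul_left, real_inner_self_eq_norm_sq] at h0
  have h2 : inner ℝ (-g) t ≤ ‖g‖ * ‖t‖ := by simpa using real_inner_le_norm (-g) t
  exact le_of_mul_le_mul_right (by nlinarith) h

end Shifted

/-! ### Mechanics of a run: multipliers, radii, acceptance and descent. -/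

section Run

variable {X : Type*} [NormedAddCommGroup X] [InnerProductSpace ℝ X] [CompleteSpace X]

theorem SolvesSubproblem.norm_eq {f : X → ℝ} {v s : X} {r lam : ℝ}
    (h : SolvesSubproblem f v r s lam) (hlam : 0 < lam) : ‖s‖ = r :=
  sub_eq_zero.1 ((mul_eq_zero.1 h.complementary).resolve_left hlam.ne')

theorem SolvesSubproblem.shifted {f : X → ℝ} {v s : X} {r lam : ℝ}
    (h : SolvesSubproblem f v r s lam) : SolvesShifted f v lam s :=
  eq_neg_of_add_eq_zero_right h.stationary

theorem SolvesSubproblem.norm_pos {f : X → ℝ} {v s : X} {r lam : ℝ}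
    (h : SolvesSubproblem f v r s lam) (hg : gradient f v ≠ 0) : 0 < ‖s‖ := by
  rw [norm_pos_iff]
  rintro rfl
  apply hg
  simpa using h.stationary

/-- Positivity of the shifted Hessian includes symmetry, and the shift is itself symmetric. -/
theorem SolvesSubproblem.hess_symm {f : X → ℝ} {v s : X} {r lam : ℝ}
    (h : SolvesSubproblem f v r s lam) (x y : X) :
    inner ℝ (hess f v x) y = inner ℝ x (hess f v y) := by
  have := h.psd.inner_left_eq_inner_right x y
  simp only [add_apply, smul_apply, ContinuousLinearMap.id_apply, inner_add_left, inner_add_right,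
    real_inner_smul_left, real_inner_smul_right] at this
  linarith

/-- A shorter solution of the shifted system belongs to a shift that is at most the multiplier. -/
theorem SolvesSubproblem.le_of_shifted {f : X → ℝ} {v s t : X} {r lam l : ℝ}
    (h : SolvesSubproblem f v r s lam) (hg : gradient f v ≠ 0) (ht : SolvesShifted f v l t)
    (hst : ‖s‖ ≤ ‖t‖) : l ≤ lam := by
  by_contra! hlt
  exact (norm_lt_of_shift_lt h.psd h.shifted ht hg hlt).not_ge hst

/-- Eliminating the gradient by stationarity, the decrease is half of `⟨s, (H + lam I) s⟩ + lam ‖s‖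
^ 2`, and the first term is nonnegative. -/
theorem SolvesSubproblem.model_decrease {f : X → ℝ} {v s : X} {r lam : ℝ}
    (h : SolvesSubproblem f v r s lam) : model f v s ≤ f v - 1 / 2 * lam * ‖s‖ ^ 2 := by
  have h0 := h.psd.inner_nonneg_right s
  simp only [add_apply, smul_apply, ContinuousLinearMap.id_apply, inner_add_right,
    real_inner_smul_right, real_inner_self_eq_norm_sq] at h0
  have h1 := congrArg (fun x => inner ℝ x s) h.stationary
  simp only [inner_add_left, inner_zero_left, real_inner_smul_left,
    real_inner_self_eq_norm_sq] at h1
  rw [h.hess_symm] at h1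
  rw [model]
  linarith

/-- Everything that convergence needs from CONTRACT: a witness shift `l > lam`, which bounds the
next multiplier from below. The last two clauses separate the geometric branch from the branch that
restores the ratio `μlow`. -/
theorem Contract.spec {p : Params} {f : X → ℝ} {v s : X} {r lam r' : ℝ}
    (h : SolvesSubproblem f v r s lam) (hg : gradient f v ≠ 0) (hc : Contract p f v s lam r') :
    ∃ (l : ℝ) (t : X), lam < l ∧ SolvesShifted f v l t ∧ r' ≤ ‖t‖ ∧
      (p.μlow * ‖s‖ ≤ lam → p.γlam * lam ≤ l) ∧ (lam < p.μlow * ‖s‖ → p.μlow * ‖t‖ ≤ l) := by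
  have hlam := h.lam_nonneg
  have hgp : 0 < ‖gradient f v‖ := norm_pos_iff.2 hg
  have hμg : 0 < p.μlow * ‖gradient f v‖ := mul_pos p.μlow_pos hgp
  have hsq : 0 < √(p.μlow * ‖gradient f v‖) := Real.sqrt_pos.2 hμg
  have hγ := p.one_lt_γlam
  unfold Contract at hc
  split_ifs at hc with h1
  · obtain ⟨t, ht, hc⟩ := hc
    split_ifs at hc with h2
    · subst hc
      refine ⟨_, t, by linarith, ht, le_rfl, fun h3 => absurd h1 h3.not_gt,
        fun _ => ?_⟩
      -- The reason for the square root: with σ the increment of the shift, σ‖t‖ ≤ ‖g‖ and σ² =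
      -- `μlow`‖g‖ yield `μlow`‖t‖ ≤ σ.
      have h3 := sub_mul_norm_le_of_shifted h.psd ht
      rw [add_sub_cancel_left] at h3
      have h4 := Real.mul_self_sqrt hμg.le
      have h5 : p.μlow * ‖t‖ ≤ √(p.μlow * ‖gradient f v‖) := by
        refine le_of_mul_le_mul_left ?_ hsq
        nlinarith [mul_le_mul_of_nonneg_left h3 p.μlow_pos.le]
      linarith
    · obtain ⟨l, u, hl1, hl2, hu, hu1, -, rfl⟩ := hc
      refine ⟨l, u, hl1, hu, le_rfl, fun h3 => absurd h1 h3.not_gt,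
        fun _ => ?_⟩
      rcases (norm_nonneg u).eq_or_lt with h3 | h3
      · rw [← h3]; linarith
      · exact (le_div_iff₀ h3).1 hu1
  · obtain ⟨t, ht, hc⟩ := hc
    have hlp : 0 < lam := (mul_pos p.μlow_pos (h.norm_pos hg)).trans_le (not_lt.1 h1)
    refine ⟨_, t, lt_mul_of_one_lt_left hlp hγ, ht, ?_, fun _ => le_rfl,
      fun h3 => absurd h3 h1⟩
    split_ifs at hc <;> rw [hc]
    exact mul_le_of_le_one_left (norm_nonneg t) p.γC_lt_one.le

/-- The trial step `s j` is accepted. -/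
def IsAccepted (p : Params) (s : ℕ → X) (lam ν μ ϱ : ℕ → ℝ) (j : ℕ) : Prop :=
  p.θ ≤ ϱ j ∧ (lam j ≤ μ j * ‖s j‖ ∨ ‖s j‖ = ν j)

theorem isAccepted_or {Y : Type*} [NormedAddCommGroup Y] {p : Params} {s : ℕ → Y}
    {lam ν μ ϱ : ℕ → ℝ} (j : ℕ) :
    IsAccepted p s lam ν μ ϱ j ∨ ϱ j < p.θ ∨
      (p.θ ≤ ϱ j ∧ ¬ (lam j ≤ μ j * ‖s j‖ ∨ ‖s j‖ = ν j)) := by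
  unfold IsAccepted
  rcases lt_or_ge (ϱ j) p.θ with h1 | h1 <;> tauto

namespace IsRun

variable {p : Params} {f : X → ℝ} {v s : ℕ → X} {lam r ν μ ϱ : ℕ → ℝ}
  (h : IsRun p f v s lam r ν μ ϱ)

include h

theorem norm_pos (j : ℕ) : 0 < ‖s j‖ := (h.subproblem j).norm_pos (h.not_stopped j)

/-- The next step is no longer than the solution at the witness shift, so its multiplier is at least
that shift. The last clause puts a following contraction into the geometric branch. -/
theorem contract_next {j : ℕ} (hj : ϱ j < p.θ) :
    v (j + 1) = v j ∧ r (j + 1) ≤ ‖s j‖ ∧ lam j < lam (j + 1) ∧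
      (p.μlow * ‖s j‖ ≤ lam j → p.γlam * lam j ≤ lam (j + 1)) ∧
      p.μlow * ‖s (j + 1)‖ ≤ lam (j + 1) := by
  obtain ⟨hv, -, hc, -⟩ := h.contract j hj
  have hg := h.not_stopped j
  obtain ⟨l, t, hl, ht, h1, h4, h5⟩ := hc.spec (h.subproblem j) hg
  have h' := h.subproblem (j + 1)
  have hle : ‖s (j + 1)‖ ≤ ‖t‖ := h'.feasible.trans h1
  have hll : l ≤ lam (j + 1) := by
    rw [hv] at h'
    exact h'.le_of_shifted hg ht hle
  have hts : ‖t‖ < ‖s j‖ :=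
    norm_lt_of_shift_lt (h.subproblem j).psd (h.subproblem j).shifted ht hg hl
  refine ⟨hv, h1.trans hts.le, hl.trans_le hll, fun h6 => (h4 h6).trans hll, ?_⟩
  have hμ := p.μlow_pos
  rcases le_or_gt (p.μlow * ‖s j‖) (lam j) with h6 | h6
  · nlinarith
  · nlinarith [h5 h6]

theorem succ_eq_of_not_accepted {j : ℕ} (hj : ¬ IsAccepted p s lam ν μ ϱ j) :
    v (j + 1) = v j ∧ ν (j + 1) = ν j := by
  rcases isAccepted_or (p := p) (s := s) (lam := lam)
        (ν := ν) (μ := μ) (ϱ := ϱ) j with h1 | h1 | h1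
  · exact absurd h1 hj
  · exact ⟨(h.contract j h1).1, (h.contract j h1).2.1⟩
  · exact ⟨(h.expand j h1).1, (h.expand j h1).2.1⟩

theorem r_le_ν (j : ℕ) : r j ≤ ν j := by
  induction j with
  | zero => exact h.r_zero_le
  | succ j ih =>
    rcases isAccepted_or (p := p) (s := s) (lam := lam)
        (ν := ν) (μ := μ) (ϱ := ϱ) j with h1 | h1 | h1
    · rw [(h.accept j h1).2.2.1]; exact min_le_left _ _
    · rw [(h.contract j h1).2.1]
      exact ((h.contract_next h1).2.1.trans (h.subproblem j).feasible).trans ih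
    · rw [(h.expand j h1).2.2.1]; exact min_le_left _ _

theorem μ_le_succ (j : ℕ) : μ j ≤ μ (j + 1) := by
  rcases isAccepted_or (p := p) (s := s) (lam := lam)
        (ν := ν) (μ := μ) (ϱ := ϱ) j with h1 | h1 | h1
  · rw [(h.accept j h1).2.2.2]; exact le_max_left _ _
  · rw [(h.contract j h1).2.2.2]; exact le_max_left _ _
  · rw [(h.expand j h1).2.2.2]

theorem μ_mono : Monotone μ := monotone_nat_of_le_succ h.μ_le_succ

theorem μ_pos (j : ℕ) : 0 < μ j :=
  p.μlow_pos.trans_le (h.μ_zero.trans (h.μ_mono (Nat.zero_le j)))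

/-- The radius strictly grows when the trial step is rejected for being too short. -/
theorem expand_next {j : ℕ} (hj : p.θ ≤ ϱ j ∧ ¬ (lam j ≤ μ j * ‖s j‖ ∨ ‖s j‖ = ν j)) :
    v (j + 1) = v j ∧ r j < r (j + 1) ∧ r (j + 1) ≤ lam j / μ j ∧ ‖s j‖ = r j := by
  obtain ⟨h1, h2, h3, -⟩ := h.expand j hj
  obtain ⟨-, h4⟩ := hj
  push Not at h4
  have hs : ‖s j‖ = r j :=
    (h.subproblem j).norm_eq ((mul_pos (h.μ_pos j) (h.norm_pos j)).trans h4.1)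
  refine ⟨h1, ?_, h3 ▸ min_le_right _ _, hs⟩
  rw [h3, lt_min_iff, h2]
  refine ⟨lt_of_le_of_ne (h.r_le_ν j) (hs ▸ h4.2), ?_⟩
  rw [lt_div_iff₀ (h.μ_pos j), mul_comm, ← hs]
  exact h4.1

/-- Two consecutive rejections: the second one is a contraction. -/
theorem lt_of_not_accepted {j : ℕ} (hj : ¬ IsAccepted p s lam ν μ ϱ j)
    (hj' : ¬ IsAccepted p s lam ν μ ϱ (j + 1)) : ϱ (j + 1) < p.θ := by
  by_contra! hθ
  refine hj' ⟨hθ, ?_⟩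
  rcases isAccepted_or (p := p) (s := s) (lam := lam)
        (ν := ν) (μ := μ) (ϱ := ϱ) j with h1 | h1 | h1
  · exact absurd h1 hj
  · left
    -- After a contraction, `μ (j + 1)` already incorporates the ratio of the trial step `j + 1`.
    rw [← div_le_iff₀ (h.norm_pos _), (h.contract j h1).2.2.2]
    exact le_max_right _ _
  · by_cases hlam : 0 < lam (j + 1)
    · have hs := (h.subproblem (j + 1)).norm_eq hlam
      obtain ⟨hv, hν, hr, hμ⟩ := h.expand j h1
      obtain ⟨-, hlt, -, hsj⟩ := h.expand_next h1
      -- Either the enlarged radius is `ν`, and the full step is acceptable as such, or it is `lam j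
      -- / μ j`; a larger radius cannot raise the multiplier, so the ratio test holds.
      rcases min_choice (ν (j + 1)) (lam j / μ j) with hm | hm
      · right; rw [hs, hr, hm]
      · left
        have h2 : lam (j + 1) ≤ lam j := by
          have h3 := (h.subproblem (j + 1)).shifted
          rw [hv] at h3
          exact (h.subproblem j).le_of_shifted (h.not_stopped j) h3 (by rw [hs, hsj]; exact hlt.le)
        rw [hs, hr, hm, hμ, mul_div_cancel₀ _ (h.μ_pos j).ne']
        exact h2
    · left
      exact (not_lt.1 hlam).trans (mul_pos (h.μ_pos _) (h.norm_pos _)).le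

/-- If the multipliers of the contractions are bounded, then infinitely many trial steps are
accepted. -/
theorem frequently_accepted {b : ℝ} (hb : ∀ j, ϱ j < p.θ → lam j ≤ b) (k : ℕ) :
    ∃ j, k ≤ j ∧ IsAccepted p s lam ν μ ϱ j := by
  by_contra! hna
  have hc : ∀ j, k + 1 ≤ j → ϱ j < p.θ := by
    intro j hj
    obtain ⟨i, rfl⟩ := Nat.exists_eq_add_of_le' (Nat.one_le_iff_ne_zero.2 (by omega : j ≠ 0))
    exact h.lt_of_not_accepted (hna _ (by omega)) (hna _ (by omega))
  -- Contractions start at `k + 1`. That first one may only restore the ratio `μlow` and make the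
  -- multiplier positive; geometric growth starts at `k + 2`.
  have hpow : ∀ n, p.γlam ^ n * lam (k + 2) ≤ lam (k + 2 + n) := by
    intro n
    induction n with
    | zero => simp
    | succ n ih =>
      have h1 := (h.contract_next (hc (k + 1 + n) (by omega))).2.2.2.2
      have e : k + 1 + n + 1 = k + 2 + n := by omega
      rw [e] at h1
      have h2 := (h.contract_next (hc (k + 2 + n) (by omega))).2.2.2.1 h1
      rw [pow_succ', mul_assoc]
      exact (mul_le_mul_of_nonneg_left ih (zero_le_one.trans p.one_lt_γlam.le)).trans h2
  have hpos : 0 < lam (k + 2) :=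
    (h.subproblem (k + 1)).lam_nonneg.trans_lt (h.contract_next (hc (k + 1) le_rfl)).2.2.1
  obtain ⟨n, hn⟩ := pow_unbounded_of_one_lt (b / lam (k + 2)) p.one_lt_γlam
  rw [div_lt_iff₀ hpos] at hn
  exact (hn.trans_le (hpow n)).not_ge (hb _ (hc _ (by omega)))

theorem accepted_decrease {j : ℕ} (hj : IsAccepted p s lam ν μ ϱ j) :
    f (v (j + 1)) + p.θ * ‖s j‖ ^ 3 ≤ f (v j) := by
  have h1 := hj.1
  rw [h.ratio j, le_div_iff₀ (pow_pos (h.norm_pos j) 3)] at h1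
  rw [(h.accept j hj).1]
  linarith

theorem antitone : Antitone fun j => f (v j) := by
  refine antitone_nat_of_succ_le fun j => ?_
  by_cases hj : IsAccepted p s lam ν μ ϱ j
  · have := h.accepted_decrease hj
    have := mul_nonneg p.θ_pos.le (pow_nonneg (norm_nonneg (s j)) 3)
    linarith
  · rw [(h.succ_eq_of_not_accepted hj).1]

/-- The accepted steps tend to zero. -/
theorem exists_accepted_norm_lt (hbdd : BddBelow (Set.range fun j => f (v j))) {δ : ℝ}
    (hδ : 0 < δ) : ∃ J, ∀ j, J ≤ j → IsAccepted p s lam ν μ ϱ j → ‖s j‖ < δ := by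
  have hlim := tendsto_atTop_ciInf h.antitone hbdd
  have hpos : 0 < p.θ * δ ^ 3 := mul_pos p.θ_pos (pow_pos hδ 3)
  obtain ⟨J, hJ⟩ := eventually_atTop.1
    (hlim.eventually (gt_mem_nhds (lt_add_of_pos_right (⨅ j, f (v j)) hpos)))
  refine ⟨J, fun j hj ha => ?_⟩
  have h1 := h.accepted_decrease ha
  have h2 := hJ j hj
  have h3 := ciInf_le hbdd (j + 1)
  have h4 : p.θ * ‖s j‖ ^ 3 < p.θ * δ ^ 3 := by linarith
  exact lt_of_pow_lt_pow_left₀ 3 hδ.le (lt_of_mul_lt_mul_left h4 p.θ_pos.le)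

/-- While the iterates stay close to each other and the accepted steps are the full radii, the
radii cannot stay below a bound. -/
theorem false_of_growth {j : ℕ} {c δ : ℝ}
    (hfreq : ∀ k, ∃ i, k ≤ i ∧ IsAccepted p s lam ν μ ϱ i) (hrj : r j < c)
    (hstep : ∀ k, j ≤ k → ‖v k - v j‖ ≤ p.γE * δ / (p.γE - 1) → r j ≤ r k → r k < c →
      (IsAccepted p s lam ν μ ϱ k ∧ ‖s k‖ = r k ∧ r (k + 1) = p.γE * r k ∧ ‖s k‖ < δ ∧
        p.γE * r k < c) ∨
      (¬ IsAccepted p s lam ν μ ϱ k ∧ r k ≤ r (k + 1) ∧ r (k + 1) < c)) (hδ : 0 < δ) : False := by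
  have hE := p.one_lt_γE
  have hE1 : 0 < p.γE - 1 := sub_pos.2 hE
  have hrpos : ∀ k, 0 < r k := fun k => (h.norm_pos k).trans_le (h.subproblem k).feasible
  -- The third clause sums the geometric series: a full step adds `r` to a displacement of at most
  -- `r / (γE - 1)`, which gives `γE * r / (γE - 1)`, the same bound for the new radius. The fourth
  -- then follows since accepted steps are shorter than `δ`.
  have hinv : ∀ n, r j ≤ r (j + n) ∧ r (j + n) < c ∧
      ‖v (j + n) - v j‖ * (p.γE - 1) ≤ r (j + n) ∧
      ‖v (j + n) - v j‖ ≤ p.γE * δ / (p.γE - 1) := by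
    intro n
    induction n with
    | zero =>
      simp only [add_zero, sub_self, norm_zero, zero_mul]
      exact ⟨le_rfl, hrj, (hrpos j).le, by positivity⟩
    | succ n ih =>
      obtain ⟨h1, h2, h3, h4⟩ := ih
      rw [← add_assoc]
      rcases hstep (j + n) (by omega) h4 h1 h2 with ⟨ha, a1, a2, a3, a4⟩ | ⟨ha, a1, a2⟩
      · have hv : ‖v (j + n + 1) - v j‖ * (p.γE - 1) ≤ p.γE * r (j + n) := by
          rw [(h.accept _ ha).1, add_sub_right_comm]
          have := norm_add_le (v (j + n) - v j) (s (j + n))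
          nlinarith
        have := hrpos (j + n)
        refine ⟨by rw [a2]; nlinarith, a2 ▸ a4, a2 ▸ hv, ?_⟩
        rw [le_div_iff₀ hE1]
        refine hv.trans ?_
        rw [← a1]
        exact mul_le_mul_of_nonneg_left a3.le (by linarith)
      · rw [(h.succ_eq_of_not_accepted ha).1]
        exact ⟨h1.trans a1, a2, h3.trans a1, h4⟩
  have hmono : Monotone fun n => r (j + n) := by
    refine monotone_nat_of_le_succ fun n => ?_
    obtain ⟨h1, h2, h3, h4⟩ := hinv n
    rcases hstep (j + n) (by omega) h4 h1 h2 with ⟨-, -, a2, -⟩ | ⟨-, a1, -⟩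
    · have := hrpos (j + n)
      simp only [← add_assoc, a2]
      nlinarith
    · exact a1
  have hbdd : BddAbove (Set.range fun n => r (j + n)) :=
    ⟨c, by rintro _ ⟨n, rfl⟩; exact (hinv n).2.1.le⟩
  set S := ⨆ n, r (j + n)
  have hS : 0 < S := (hrpos (j + 0)).trans_le (le_ciSup hbdd 0)
  -- Once a radius exceeds `S / γE`, the next acceptance pushes it above the supremum `S`.
  obtain ⟨n, hn⟩ := exists_lt_of_lt_ciSup
    (show S / p.γE < ⨆ n, r (j + n) from div_lt_self hS hE)
  obtain ⟨i, hi, ha⟩ := hfreq (j + n)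
  obtain ⟨m, rfl⟩ := Nat.exists_eq_add_of_le (show j ≤ i by omega)
  obtain ⟨h1, h2, h3, h4⟩ := hinv m
  rcases hstep (j + m) (by omega) h4 h1 h2 with ⟨-, -, a2, -⟩ | ⟨hna, -⟩
  · have h5 : r (j + n) ≤ r (j + m) := hmono (by omega)
    have h6 : r (j + (m + 1)) ≤ S := le_ciSup hbdd (m + 1)
    rw [← add_assoc, a2] at h6
    rw [div_lt_iff₀ (by linarith)] at hn
    nlinarith
  · exact hna ha

end IsRun

end Run

/-! ### Cluster points and the convergence theorem. -/

section Limit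

variable {X : Type*} [NormedAddCommGroup X] [InnerProductSpace ℝ X] [CompleteSpace X]

/-- Uniform bounds along a run: `K` for the Hessians, `G` for the gradients, `R` for the radii, and
`C` for the ratios of the multipliers to the steps in the contractions. -/
structure RunBounds (p : Params) (f : X → ℝ) (v s : ℕ → X) (lam r ϱ : ℕ → ℝ) (K G R C : ℝ) :
    Prop where
  hess_le : ∀ j, ‖hess f (v j)‖ ≤ K
  gradient_le : ∀ j, ‖gradient f (v j)‖ ≤ G
  r_le : ∀ j, r j ≤ R
  C_nonneg : 0 ≤ C
  lam_le : ∀ j, ϱ j < p.θ → lam j ≤ C * ‖s j‖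
  bddBelow : BddBelow (Set.range fun j => f (v j))

namespace IsRun

variable {p : Params} {f : X → ℝ} {v s : ℕ → X} {lam r ν μ ϱ : ℕ → ℝ} {K G R C : ℝ}

theorem exists_norm_le (h : IsRun p f v s lam r ν μ ϱ)
    (hb : ∀ a, Bornology.IsBounded {x | f x ≤ a}) : ∃ ρ, ∀ j, ‖v j‖ ≤ ρ := by
  obtain ⟨ρ, hρ⟩ := isBounded_iff_forall_norm_le.1 (hb (f (v 0)))
  exact ⟨ρ, fun j => hρ _ (h.antitone (Nat.zero_le j))⟩

/-- The cap `ν` changes only at acceptances, where the step is a difference of two iterates and so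
has length at most `2 * ρ`. -/
theorem exists_r_le (h : IsRun p f v s lam r ν μ ϱ) {ρ : ℝ} (hv : ∀ j, ‖v j‖ ≤ ρ) :
    ∃ R, ∀ j, r j ≤ R := by
  refine ⟨max (ν 0) (p.γE * (2 * ρ)), fun j => (h.r_le_ν j).trans ?_⟩
  induction j with
  | zero => exact le_max_left _ _
  | succ j ih =>
    by_cases hj : IsAccepted p s lam ν μ ϱ j
    · rw [(h.accept j hj).2.1]
      refine max_le ih (le_max_of_le_right ?_)
      have h1 : s j = v (j + 1) - v j := by rw [(h.accept j hj).1]; simp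
      have h2 : ‖s j‖ ≤ 2 * ρ := by
        rw [h1]
        linarith [norm_sub_le (v (j + 1)) (v j), hv j, hv (j + 1)]
      exact mul_le_mul_of_nonneg_left h2 (zero_le_one.trans p.one_lt_γE.le)
    · rw [(h.succ_eq_of_not_accepted hj).2]; exact ih

theorem exists_runBounds [FiniteDimensional ℝ X] (h : IsRun p f v s lam r ν μ ϱ)
    (hf : ContDiff ℝ 3 f) (hb : ∀ a, Bornology.IsBounded {x | f x ≤ a}) :
    ∃ K G R C : ℝ, RunBounds p f v s lam r ϱ K G R C := by
  obtain ⟨ρ, hv⟩ := h.exists_norm_le hb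
  obtain ⟨R, hR⟩ := h.exists_r_le hv
  have hcpt := isCompact_closedBall (0 : X) ρ
  have hmem : ∀ j, v j ∈ Metric.closedBall (0 : X) ρ := fun j => by simpa using hv j
  obtain ⟨K, hK⟩ := hcpt.exists_bound_of_continuousOn (contDiff_hess hf).continuous.continuousOn
  obtain ⟨G, hG⟩ := hcpt.exists_bound_of_continuousOn
    (contDiff_gradient hf).continuous.continuousOn
  obtain ⟨b, hb⟩ := hcpt.bddBelow_image hf.continuous.continuousOn
  -- The radius `ρ + R` also covers rejected trial points, which may leave the sublevel set.
  obtain ⟨L, hL0, hL⟩ := exists_le_model_add hf (ρ + R)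
  have hR0 : 0 ≤ R := (norm_nonneg _).trans ((h.subproblem 0).feasible.trans (hR 0))
  refine ⟨K, G, R, 2 * (p.θ + L), fun j => hK _ (hmem j), fun j => hG _ (hmem j), hR,
    by linarith [p.θ_pos], fun j hj => ?_,
    ⟨b, by rintro _ ⟨j, rfl⟩; exact hb ⟨_, hmem j, rfl⟩⟩⟩
  have hs := h.norm_pos j
  have h1 := hL (v j) (s j) (by linarith [hv j])
    ((norm_add_le _ _).trans (add_le_add (hv j) ((h.subproblem j).feasible.trans (hR j))))
    (h.subproblem j).hess_symm
  have h2 := (h.subproblem j).model_decrease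
  rw [h.ratio j, div_lt_iff₀ (pow_pos hs 3)] at hj
  have h3 : lam j * ‖s j‖ ^ 2 < 2 * (p.θ + L) * ‖s j‖ * ‖s j‖ ^ 2 := by nlinarith
  exact (lt_of_mul_lt_mul_right h3 (by positivity)).le

/-- A point cannot be approached infinitely often if, close to it, short steps have a multiplier
that dominates the step and the multipliers of later rejected steps are controlled. -/
theorem not_mapClusterPt (h : IsRun p f v s lam r ν μ ϱ)
    (hB : RunBounds p f v s lam r ϱ K G R C) {w : X} {η c δ : ℝ} (hη : 0 < η) (hc : 0 < c)
    (hδ : 0 < δ)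
    (hlam : ∀ k, ‖v k - w‖ < η → ‖s k‖ < c → C * ‖s k‖ < lam k)
    (hratio : ∀ i k, ‖v i - w‖ < η → ‖v k - w‖ < η → ‖s i‖ < δ → ‖s i‖ ≤ ‖s k‖ →
      lam k * ‖s i‖ < c * lam i) : ¬ MapClusterPt w atTop v := by
  intro hw
  have hE := p.one_lt_γE
  have hE1 : 0 < p.γE - 1 := sub_pos.2 hE
  have hfreq := h.frequently_accepted (b := C * R) fun j hj => (hB.lam_le j hj).trans
    (mul_le_mul_of_nonneg_left ((h.subproblem j).feasible.trans (hB.r_le j)) hB.C_nonneg)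
  -- accepted steps shorter than `d` move the iterates by less than `η / 2`
  obtain ⟨d, hd, hdδ, hd1, hd2, hd3⟩ : ∃ d, 0 < d ∧ d ≤ δ ∧ p.γE * (p.γE * d) ≤ c ∧
      p.γE * d / (p.γE - 1) ≤ η / 4 ∧ d ≤ η / 4 := by
    refine ⟨min (min δ (η / 4)) (min (c / (p.γE * p.γE)) (η / 4 * (p.γE - 1) / p.γE)), ?_,
      (min_le_left _ _).trans (min_le_left _ _), ?_, ?_,
      (min_le_left _ _).trans (min_le_right _ _)⟩
    · have : 0 < p.γE := by linarith
      refine lt_min (lt_min hδ (by positivity)) (lt_min (by positivity) (by positivity))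
    · have h0 : 0 < p.γE * p.γE := by positivity
      rw [← mul_assoc, mul_comm, ← le_div_iff₀ h0]
      exact (min_le_right _ _).trans (min_le_left _ _)
    · have h0 : 0 < p.γE := by linarith
      rw [div_le_iff₀ hE1, mul_comm, ← le_div_iff₀ h0]
      exact (min_le_right _ _).trans (min_le_right _ _)
  obtain ⟨J, hJ⟩ := h.exists_accepted_norm_lt hB.bddBelow hd
  have hdc : p.γE * d ≤ c := le_trans (by nlinarith [mul_pos (show 0 < p.γE by linarith) hd]) hd1
  have hdc' : d ≤ c := le_trans (by nlinarith) hdc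
  -- The distance `η` is split into `η / 2` for the start, `η / 4` for the accepted step `i` and `η
  -- / 4` for all later motion.
  obtain ⟨j, hj, hvj⟩ := (mapClusterPt_iff_frequently.1 hw _
    (Metric.ball_mem_nhds w (show 0 < η / 2 by linarith))).forall_exists_of_atTop J
  -- the next accepted step `i`
  have hex := hfreq j
  classical
  obtain ⟨i, hi, ha, hmin⟩ : ∃ i, j ≤ i ∧ IsAccepted p s lam ν μ ϱ i ∧
      ∀ m, j ≤ m → m < i → ¬ IsAccepted p s lam ν μ ϱ m :=
    ⟨Nat.find hex, (Nat.find_spec hex).1, (Nat.find_spec hex).2,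
      fun m hm hmi hma => Nat.find_min hex hmi ⟨hm, hma⟩⟩
  have hvi : v i = v j := by
    have : ∀ n, j + n ≤ i → v (j + n) = v j := by
      intro n
      induction n with
      | zero => simp
      | succ n ih =>
        intro hn
        rw [← add_assoc, (h.succ_eq_of_not_accepted (hmin (j + n) (by omega) (by omega))).1]
        exact ih (by omega)
    have := this (i - j) (by omega)
    rwa [Nat.add_sub_cancel' hi] at this
  have hwi : ‖v i - w‖ < η / 2 := by rw [hvi, ← dist_eq_norm]; exact hvj
  have hsi : ‖s i‖ < d := hJ i (hj.trans hi) ha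
  have hCs : ∀ k, 0 ≤ C * ‖s k‖ := fun k => mul_nonneg hB.C_nonneg (norm_nonneg _)
  have hlami : 0 < lam i := (hCs i).trans_lt (hlam i (by linarith) (by linarith))
  have hlong : ∀ k, IsAccepted p s lam ν μ ϱ k → ‖s k‖ = r k → r (k + 1) = p.γE * r k := by
    intro k hk hs
    obtain ⟨-, hν, hr, -⟩ := h.accept k hk
    have : 0 < r k := hs ▸ h.norm_pos k
    rw [hr, hν, hs, max_eq_right (show r k ≤ p.γE * r k by nlinarith)]
    exact min_eq_right (le_max_right _ _)
  have hri : r (i + 1) = p.γE * ‖s i‖ := by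
    have := (h.subproblem i).norm_eq hlami
    rw [hlong i ha this, this]
  have hμi : lam i / ‖s i‖ ≤ μ (i + 1) := by
    rw [(h.accept i ha).2.2.2]; exact le_max_right _ _
  have hsi0 := h.norm_pos i
  have hwi1 : ‖v (i + 1) - w‖ < 3 * η / 4 := by
    rw [(h.accept i ha).1, add_sub_right_comm]
    linarith [norm_add_le (v i - w) (s i)]
  refine h.false_of_growth (j := i + 1) (c := c) (δ := d) hfreq (by rw [hri]; nlinarith) ?_ hd
  intro k hk hvk hrk hrc
  have hwk : ‖v k - w‖ < η := by
    have := norm_sub_le_norm_sub_add_norm_sub (v k) (v (i + 1)) w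
    linarith
  have hsk : ‖s k‖ < c := (h.subproblem k).feasible.trans_lt hrc
  have hCk := hlam k hwk hsk
  have hnorm := (h.subproblem k).norm_eq ((hCs k).trans_lt hCk)
  rcases isAccepted_or (p := p) (s := s) (lam := lam) (ν := ν) (μ := μ) (ϱ := ϱ) k
    with h1 | h1 | h1
  · have h2 := hJ k (by omega) h1
    refine Or.inl ⟨h1, hnorm, hlong k h1 hnorm, h2, ?_⟩
    rw [← hnorm]
    nlinarith
  -- A contraction would require `lam k ≤ C * ‖s k‖`.
  · exact absurd hCk (hB.lam_le k h1).not_gt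
  · right
    obtain ⟨-, h3, h4, -⟩ := h.expand_next h1
    refine ⟨fun ha' => h1.2 ha'.2, h3.le, h4.trans_lt ?_⟩
    have h5 : ‖s i‖ ≤ ‖s k‖ := by
      rw [hnorm]
      refine le_trans ?_ hrk
      rw [hri]
      nlinarith
    have h6 := hratio i k (by linarith) hwk (hsi.trans_le hdδ) h5
    rw [div_lt_iff₀ (h.μ_pos k)]
    -- The ratio recorded when step `i` was accepted persists in `μ`, which keeps the expanded
    -- radius `lam k / μ k` below `c`.
    have h7 : lam i / ‖s i‖ ≤ μ k := hμi.trans (h.μ_mono hk)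
    have h8 : lam k < c * (lam i / ‖s i‖) := by
      rw [← mul_div_assoc, lt_div_iff₀ hsi0]; exact h6
    exact h8.trans_le (mul_le_mul_of_nonneg_left h7 hc.le)

/-- Where ‖g‖ > ε, stationarity gives `(K + lam) * ‖s‖ > ε`, so short steps have large multipliers,
while `lam * ‖s‖ ≤ G + K * R` always. The constants `c` and `δ` are solved from these two
inequalities. -/
theorem gradient_eq_zero_of_mapClusterPt (h : IsRun p f v s lam r ν μ ϱ)
    (hB : RunBounds p f v s lam r ϱ K G R C) (hgc : Continuous (gradient f)) {w : X}
    (hw : MapClusterPt w atTop v) : gradient f w = 0 := by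
  by_contra hg
  have hK : 0 ≤ K := (norm_nonneg _).trans (hB.hess_le 0)
  have hG : 0 ≤ G := (norm_nonneg _).trans (hB.gradient_le 0)
  have hs : ∀ k, ‖s k‖ ≤ R := fun k => (h.subproblem k).feasible.trans (hB.r_le k)
  have hR : 0 ≤ R := (norm_nonneg _).trans (hs 0)
  have hC := hB.C_nonneg
  obtain ⟨ε, hε, hεg⟩ := exists_between (norm_pos_iff.2 hg)
  obtain ⟨η, hη, hball⟩ := Metric.eventually_nhds_iff.1
    (hgc.norm.continuousAt.eventually (lt_mem_nhds hεg))
  simp only [dist_eq_norm] at hball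
  have hup : ∀ k, lam k * ‖s k‖ ≤ G + K * R := fun k =>
    (mul_norm_le_of_shifted (hB.hess_le k) (h.subproblem k).lam_nonneg
      (h.subproblem k).shifted).trans (add_le_add (hB.gradient_le k)
        (mul_le_mul_of_nonneg_left (hs k) hK))
  have hlow : ∀ k, ‖v k - w‖ < η → ε < (K + lam k) * ‖s k‖ := fun k hk =>
    (hball hk).trans_le (norm_le_of_shifted (hB.hess_le k) (h.subproblem k).lam_nonneg
      (h.subproblem k).shifted)
  have hc : 0 < ε / (C * R + K + 1) := by positivity
  set c := ε / (C * R + K + 1) with hcdef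
  have hδ : 0 < c * ε / (G + K * R + c * K + 1) := by positivity
  refine h.not_mapClusterPt hB hη hc hδ (fun k hk hsk => ?_) (fun i k hi hk hsi hik => ?_) hw
  · have h1 := hlow k hk
    rw [hcdef, lt_div_iff₀ (by positivity)] at hsk
    have h0 := h.norm_pos k
    have h2 : C * ‖s k‖ * ‖s k‖ ≤ C * R * ‖s k‖ :=
      mul_le_mul_of_nonneg_right (mul_le_mul_of_nonneg_left (hs k) hC) h0.le
    exact lt_of_mul_lt_mul_right (show C * ‖s k‖ * ‖s k‖ < lam k * ‖s k‖ by nlinarith) h0.le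
  · have h0 := h.norm_pos i
    have h1 := hlow i hi
    rw [lt_div_iff₀ (by positivity)] at hsi
    have h2 : lam k * ‖s i‖ ≤ G + K * R :=
      (mul_le_mul_of_nonneg_left hik (h.subproblem k).lam_nonneg).trans (hup k)
    have h3 : c * ε < c * ((K + lam i) * ‖s i‖) := mul_lt_mul_of_pos_left h1 hc
    have h4 : lam k * ‖s i‖ * ‖s i‖ ≤ (G + K * R) * ‖s i‖ := mul_le_mul_of_nonneg_right h2 h0.le
    exact lt_of_mul_lt_mul_right
      (show lam k * ‖s i‖ * ‖s i‖ < c * lam i * ‖s i‖ by nlinarith) h0.le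

/-- Negative curvature along `u` forces `lam > ε` nearby. The gradient must be known to vanish at
`w` first: its smallness bounds `(lam k - K) * ‖s k‖` by half of `c * ε`, and the choice of `δ`
bounds `K * ‖s i‖` by the other half. -/
theorem inner_hess_nonneg_of_mapClusterPt (h : IsRun p f v s lam r ν μ ϱ)
    (hB : RunBounds p f v s lam r ϱ K G R C) (hgc : Continuous (gradient f))
    (hHc : Continuous (hess f)) {w : X} (hw : MapClusterPt w atTop v) (u : X) :
    0 ≤ inner ℝ u (hess f w u) := by
  by_contra! hu
  have hg := h.gradient_eq_zero_of_mapClusterPt hB hgc hw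
  have hK : 0 ≤ K := (norm_nonneg _).trans (hB.hess_le 0)
  have hC := hB.C_nonneg
  have hu0 : 0 < ‖u‖ ^ 2 := by
    refine pow_pos (norm_pos_iff.2 ?_) 2
    rintro rfl
    simp at hu
  obtain ⟨ε, hε, hεu⟩ : ∃ ε, 0 < ε ∧ inner ℝ u (hess f w u) < -(ε * ‖u‖ ^ 2) := by
    refine ⟨-inner ℝ u (hess f w u) / 2 / ‖u‖ ^ 2, div_pos (by linarith) hu0, ?_⟩
    rw [div_mul_cancel₀ _ hu0.ne']
    linarith
  have hc : 0 < ε / (C + 1) := by positivity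
  set c := ε / (C + 1) with hcdef
  have hcont : Continuous fun x => inner ℝ u (hess f x u) := by fun_prop
  obtain ⟨η, hη, hball⟩ := Metric.eventually_nhds_iff.1
    ((hcont.continuousAt.eventually (gt_mem_nhds hεu)).and
      (hgc.norm.continuousAt.eventually (gt_mem_nhds
        (show ‖gradient f w‖ < c * ε / 2 by rw [hg, norm_zero]; positivity))))
  simp only [dist_eq_norm] at hball
  have hlow : ∀ k, ‖v k - w‖ < η → ε < lam k := by
    intro k hk
    have h1 := (h.subproblem k).psd.inner_nonneg_right u
    simp only [add_apply, smul_apply, ContinuousLinearMap.id_apply, inner_add_right,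
      real_inner_smul_right, real_inner_self_eq_norm_sq] at h1
    have h2 := (hball hk).1
    exact lt_of_mul_lt_mul_right (show ε * ‖u‖ ^ 2 < lam k * ‖u‖ ^ 2 by linarith) hu0.le
  have hδ : 0 < c * ε / 2 / (K + 1) := by positivity
  refine h.not_mapClusterPt hB hη hc hδ (fun k hk hsk => ?_) (fun i k hi hk hsi hik => ?_) hw
  · rw [hcdef, lt_div_iff₀ (by positivity)] at hsk
    nlinarith [hlow k hk, norm_nonneg (s k)]
  · have h1 := mul_norm_le_of_shifted (hB.hess_le k) (h.subproblem k).lam_nonneg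
      (h.subproblem k).shifted
    rw [lt_div_iff₀ (by positivity)] at hsi
    have hsi0 := h.norm_pos i
    have hsk0 := h.norm_pos k
    have h2 := (hball hk).2
    have h3 : c * ε < c * lam i := mul_lt_mul_of_pos_left (hlow i hi) hc
    rcases le_total (lam k) K with h4 | h4
    · nlinarith [norm_nonneg (gradient f (v k))]
    · nlinarith [mul_le_mul_of_nonneg_left hik (sub_nonneg.2 h4)]

theorem isSecondOrderStationary_of_mapClusterPt (h : IsRun p f v s lam r ν μ ϱ)
    (hB : RunBounds p f v s lam r ϱ K G R C) (hgc : Continuous (gradient f))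
    (hHc : Continuous (hess f)) {w : X} (hw : MapClusterPt w atTop v) :
    IsSecondOrderStationary f w := by
  refine ⟨h.gradient_eq_zero_of_mapClusterPt hB hgc hw,
    (ContinuousLinearMap.isPositive_iff _).2 ⟨fun x y => ?_, fun x => ?_⟩⟩
  · have hcl : IsClosed {z | inner ℝ (hess f z x) y = inner ℝ x (hess f z y)} :=
      isClosed_eq (by fun_prop) (by fun_prop)
    exact hcl.mem_of_mapClusterPt hw (Eventually.of_forall fun j => (h.subproblem j).hess_symm x y)
  · rw [real_inner_comm]
    exact h.inner_hess_nonneg_of_mapClusterPt hB hgc hHc hw x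

/-- A property that holds close to the second-order stationary points holds eventually along a
run. -/
theorem eventually_of_stationary [FiniteDimensional ℝ X] (h : IsRun p f v s lam r ν μ ϱ)
    (hf : ContDiff ℝ 3 f) (hb : ∀ a, Bornology.IsBounded {x | f x ≤ a}) {Q : X → Prop}
    (hQ : ∀ w, IsSecondOrderStationary f w → ∀ᶠ x in 𝓝 w, Q x) : ∀ᶠ j in atTop, Q (v j) := by
  obtain ⟨K, G, R, C, hB⟩ := h.exists_runBounds hf hb
  obtain ⟨ρ, hv⟩ := h.exists_norm_le hb
  by_contra hnot
  have hclosed : IsClosed (interior {x | Q x})ᶜ := isOpen_interior.isClosed_compl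
  obtain ⟨w, hwmem, hw⟩ := ((isCompact_closedBall (0 : X) ρ).inter_right
    hclosed).exists_mapClusterPt_of_frequently (l := atTop) (f := v)
    ((not_eventually.1 hnot).mono fun j hj =>
      ⟨by simpa using hv j, fun hint => hj (interior_subset hint)⟩)
  exact hwmem.2 (mem_interior_iff_mem_nhds.2 (hQ w (h.isSecondOrderStationary_of_mapClusterPt hB
    (contDiff_gradient hf).continuous (contDiff_hess hf).continuous hw)))

/-- Global convergence of the trust region method to second-order stationary points. -/
theorem tendsto_stationary [FiniteDimensional ℝ X] (h : IsRun p f v s lam r ν μ ϱ)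
    (hf : ContDiff ℝ 3 f) (hb : ∀ a, Bornology.IsBounded {x | f x ≤ a}) :
    Tendsto (fun j => ‖gradient f (v j)‖) atTop (𝓝 0) ∧
    0 ≤ liminf (fun j => minEigenvalue (hess f (v j))) atTop ∧
    Tendsto (fun j => Metric.infEDist (v j) {w | IsSecondOrderStationary f w}) atTop (𝓝 0) := by
  refine ⟨?_, ?_, ?_⟩
  · refine (tendsto_order.2 ⟨fun a ha => Eventually.of_forall fun j => ha.trans_le (norm_nonneg _),
      fun a ha => h.eventually_of_stationary hf hb (Q := fun x => ‖gradient f x‖ < a)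
        fun w hw => ?_⟩)
    refine (contDiff_gradient hf).continuous.norm.continuousAt.eventually (gt_mem_nhds ?_)
    simpa [hw.1] using ha
  · refine le_of_forall_lt fun a ha => ?_
    obtain ⟨b, hab, hb0⟩ := EReal.lt_iff_exists_real_btwn.1 ha
    refine hab.trans_le (le_liminf_of_le (by isBoundedDefault) ?_)
    have hb0 : b < 0 := by exact_mod_cast hb0
    refine h.eventually_of_stationary hf hb (Q := fun x => (b : EReal) ≤ minEigenvalue (hess f x))
      fun w hw => ?_
    -- A perturbation of operator norm below `-b` cannot push the quadratic form of a positive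
    -- operator below `b` on unit vectors.
    have hnear : ∀ᶠ x in 𝓝 w, ‖hess f x - hess f w‖ < -b :=
      ((contDiff_hess hf).continuous.sub continuous_const).norm.continuousAt.eventually
        (gt_mem_nhds (by simpa using hb0))
    filter_upwards [hnear] with x hx
    refine le_iInf fun u => EReal.coe_le_coe_iff.2 ?_
    have h1 := hw.2.inner_nonneg_right u.1
    have h2 := abs_le.1 (abs_real_inner_le_norm u.1 ((hess f x - hess f w) u.1))
    have h3 := (hess f x - hess f w).le_opNorm u.1
    rw [u.2] at h2 h3
    have h4 := h2.1
    rw [sub_apply, inner_sub_right, ← sub_apply] at h4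
    linarith
  · refine ENNReal.tendsto_nhds_zero.2 fun ε hε => h.eventually_of_stationary hf hb
      (Q := fun x : X => Metric.infEDist x {w : X | IsSecondOrderStationary f w} ≤ ε) fun w hw => ?_
    filter_upwards [Metric.eball_mem_nhds w hε] with x hx using
      (Metric.infEDist_le_edist_of_mem (s := {w : X | IsSecondOrderStationary f w}) hw).trans
        (le_of_lt hx)

end IsRun

end Limit

end TrustRegion

namespace LandauBrazovskii

/-! ### Discrete Fourier analysis on the grid. -/

section Orthogonality

variable {d M : ℕ}

/-- The character `exp (2πi q·x / M)` of the grid. -/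
noncomputable def phase (M : ℕ) {d : ℕ} (q x : Fin d → ℤ) : ℂ :=
  ∏ a, Complex.exp (2 * Real.pi * Complex.I * ((q a * x a : ℤ) : ℂ) / M)

theorem phase_add_left (q q' x : Fin d → ℤ) : phase M (q + q') x = phase M q x * phase M q' x := by
  simp only [phase, ← Finset.prod_mul_distrib, ← Complex.exp_add]
  refine Finset.prod_congr rfl fun a _ => congrArg _ ?_
  push_cast [Pi.add_apply]
  ring

theorem phase_comm (q x : Fin d → ℤ) : phase M q x = phase M x q := by
  simp only [phase, mul_comm (q _)]

theorem norm_phase (q x : Fin d → ℤ) : ‖phase M q x‖ = 1 := by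
  rw [phase, norm_prod]
  refine Finset.prod_eq_one fun a _ => ?_
  rw [show 2 * (Real.pi : ℂ) * Complex.I * ((q a * x a : ℤ) : ℂ) / M
    = ((2 * Real.pi * ((q a * x a : ℤ) : ℝ) / M : ℝ) : ℂ) * Complex.I by push_cast; ring]
  exact Complex.norm_exp_ofReal_mul_I _

theorem sum_range_exp (hM : 0 < M) (q : ℤ) :
    ∑ m ∈ Finset.range M, Complex.exp (2 * Real.pi * Complex.I * ((q * (m : ℤ) : ℤ) : ℂ) / M)
      = if (M : ℤ) ∣ q then (M : ℂ) else 0 := by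
  have hM' : (M : ℂ) ≠ 0 := by exact_mod_cast hM.ne'
  have hz : ∀ m : ℕ, Complex.exp (2 * Real.pi * Complex.I * ((q * (m : ℤ) : ℤ) : ℂ) / M)
      = Complex.exp (2 * Real.pi * Complex.I * q / M) ^ m := by
    intro m
    rw [← Complex.exp_nat_mul]
    congr 1
    push_cast
    ring
  have hone : Complex.exp (2 * Real.pi * Complex.I * q / M) = 1 ↔ (M : ℤ) ∣ q := by
    rw [Complex.exp_eq_one_iff]
    refine exists_congr fun n => ?_
    rw [div_eq_iff hM', show (n : ℂ) * (2 * Real.pi * Complex.I) * M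
      = 2 * Real.pi * Complex.I * ((M : ℂ) * n) by ring,
      mul_right_inj' Complex.two_pi_I_ne_zero]
    exact_mod_cast Iff.rfl
  simp only [hz]
  split_ifs with h
  · simp [hone.2 h]
  · have hne : Complex.exp (2 * Real.pi * Complex.I * q / M) ≠ 1 := fun h1 => h (hone.1 h1)
    rw [geom_sum_eq hne, ← Complex.exp_nat_mul, mul_div_cancel₀ _ hM',
      show 2 * (Real.pi : ℂ) * Complex.I * q = q * (2 * Real.pi * Complex.I) by ring,
      Complex.exp_int_mul_two_pi_mul_I, sub_self, zero_div]

theorem prod_ite_dvd (q : Fin d → ℤ) :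
    (∏ a, if (M : ℤ) ∣ q a then (M : ℂ) else 0) = if Vanishes M q then (M : ℂ) ^ d else 0 := by
  split_ifs with h
  · rw [Finset.prod_congr rfl fun a _ => if_pos (h a)]
    simp
  · obtain ⟨a, ha⟩ := not_forall.1 h
    exact Finset.prod_eq_zero (Finset.mem_univ a) (if_neg ha)

/-- Orthogonality of the characters, summed over the grid. -/
theorem sum_grid_phase (hM : 0 < M) (q : Fin d → ℤ) :
    ∑ i : Fin d → Fin M, phase M q (fun a => ((i a : ℕ) : ℤ))
      = if Vanishes M q then (M : ℂ) ^ d else 0 := by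
  rw [← prod_ite_dvd]
  simp only [phase, ← sum_range_exp hM, ← Fin.sum_univ_eq_sum_range (fun m : ℕ =>
    Complex.exp (2 * Real.pi * Complex.I * ((q _ * (m : ℤ) : ℤ) : ℂ) / M))]
  rw [Finset.prod_univ_sum, Fintype.piFinset_univ]

/-- The one-dimensional frequencies are `M` consecutive integers starting at `-⌊M/2⌋`, for either
parity of `M`. -/
theorem filter_eq_image :
    ((Finset.Icc (-(M : ℤ)) (M : ℤ)).filter fun m => -(M : ℤ) ≤ 2 * m ∧ 2 * m < (M : ℤ))
      = (Finset.range M).image fun m : ℕ => (m : ℤ) - (M / 2 : ℕ) := by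
  ext m
  simp only [Finset.mem_filter, Finset.mem_Icc, Finset.mem_image, Finset.mem_range]
  constructor
  · rintro ⟨-, h1, h2⟩
    exact ⟨(m + (M / 2 : ℕ)).toNat, by omega, by omega⟩
  · rintro ⟨n, hn, rfl⟩
    omega

/-- Orthogonality of the characters, summed over the reciprocal space. -/
theorem sum_freq_phase (hM : 0 < M) (y : Fin d → ℤ) :
    ∑ k : Freq d M, phase M k.1 y = if Vanishes M y then (M : ℂ) ^ d else 0 := by
  rw [← prod_ite_dvd, Finset.sum_coe_sort (freqSet d M) (fun k => phase M k y)]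
  simp only [phase, freqSet]
  refine (Finset.prod_univ_sum _ fun a (m : ℤ) =>
    Complex.exp (2 * Real.pi * Complex.I * ((m * y a : ℤ) : ℂ) / M)).symm.trans ?_
  refine Finset.prod_congr rfl fun a _ => ?_
  rw [filter_eq_image, Finset.sum_image (fun m _ n _ h => by simpa using h)]
  have h1 : ∀ m : ℕ, Complex.exp
      (2 * Real.pi * Complex.I * ((((m : ℤ) - (M / 2 : ℕ)) * y a : ℤ) : ℂ) / M)
      = Complex.exp (2 * Real.pi * Complex.I * ((-(M / 2 : ℕ) * y a : ℤ) : ℂ) / M)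
        * Complex.exp (2 * Real.pi * Complex.I * ((y a * (m : ℤ) : ℤ) : ℂ) / M) := by
    intro m
    rw [← Complex.exp_add]
    congr 1
    push_cast
    ring
  simp only [h1, ← Finset.mul_sum, sum_range_exp hM]
  -- The phase due to the offset `M / 2` is 1 if `M` divides `y a`; otherwise the geometric sum
  -- vanishes anyway.
  split_ifs with h
  · obtain ⟨n, hn⟩ := h
    have hM' : (M : ℂ) ≠ 0 := by exact_mod_cast hM.ne'
    have h2 : 2 * Real.pi * Complex.I * ((-(M / 2 : ℕ) * y a : ℤ) : ℂ) / M
        = ((-(M / 2 : ℕ) * n : ℤ) : ℂ) * (2 * Real.pi * Complex.I) := by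
      rw [hn]
      push_cast
      field_simp
    rw [h2, Complex.exp_int_mul_two_pi_mul_I, one_mul]
  · rw [mul_zero]

variable {A B : Matrix (Fin d) (Fin d) ℝ}

/-- For square matrices the hypothesis also gives `Bᵀ * A = 2π I`, so the lattice drops out and only
integer characters remain. -/
theorem waveVec_dotProduct_gridPoint
    (hAB : A * Bᵀ = (2 * Real.pi) • (1 : Matrix (Fin d) (Fin d) ℝ)) (k : Fin d → ℤ)
    (i : Fin d → Fin M) :
    waveVec B k ⬝ᵥ gridPoint A i
      = ∑ a, 2 * Real.pi * ((k a : ℝ) * (((i a : ℕ) : ℝ) / (M : ℝ))) := by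
  have hpi : (2 * Real.pi) ≠ 0 := by positivity
  have h1 : ((2 * Real.pi)⁻¹ • A) * Bᵀ = 1 := by
    rw [Matrix.smul_mul, hAB, smul_smul, inv_mul_cancel₀ hpi, one_smul]
  have h2 : Bᵀ * A = (2 * Real.pi) • (1 : Matrix (Fin d) (Fin d) ℝ) := by
    have h3 := mul_eq_one_comm.1 h1
    rw [Matrix.mul_smul] at h3
    rw [← h3, smul_smul, mul_inv_cancel₀ hpi, one_smul]
  rw [waveVec, gridPoint, Matrix.dotProduct_mulVec, ← Matrix.mulVec_transpose, Matrix.mulVec_mulVec,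
    ← Matrix.transpose_transpose B, ← Matrix.transpose_mul, h2]
  simp only [Matrix.transpose_smul, Matrix.transpose_one, Matrix.smul_mulVec, Matrix.one_mulVec,
    dotProduct, Pi.smul_apply, smul_eq_mul, mul_assoc]

theorem dft_eq (hAB : A * Bᵀ = (2 * Real.pi) • (1 : Matrix (Fin d) (Fin d) ℝ))
    (ψ : (Fin d → Fin M) → ℝ) (k : Freq d M) :
    dft A B ψ k = 1 / (M : ℂ) ^ d *
      ∑ i, (ψ i : ℂ) * phase M k.1 (-fun a => ((i a : ℕ) : ℤ)) := by
  rw [dft]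
  congr 1
  refine Finset.sum_congr rfl fun i _ => ?_
  rw [waveVec_dotProduct_gridPoint hAB, phase, ← Complex.exp_sum]
  congr 2
  push_cast [Finset.mul_sum, Pi.neg_apply]
  refine Finset.sum_congr rfl fun a _ => ?_
  ring

theorem vanishes_sub_iff (i j : Fin d → Fin M) :
    Vanishes M ((fun a => ((i a : ℕ) : ℤ)) + -fun a => ((j a : ℕ) : ℤ)) ↔ i = j := by
  constructor
  · intro h
    ext a
    have h1 := Int.eq_zero_of_abs_lt_dvd (h a) (by
      simp only [Pi.add_apply, Pi.neg_apply]
      have := (i a).2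
      have := (j a).2
      rw [abs_lt]
      omega)
    simp only [Pi.add_apply, Pi.neg_apply] at h1
    omega
  · rintro rfl a
    simp

/-- Fourier inversion on the grid. -/
theorem sum_dft_mul_phase (hM : 0 < M)
    (hAB : A * Bᵀ = (2 * Real.pi) • (1 : Matrix (Fin d) (Fin d) ℝ))
    (ψ : (Fin d → Fin M) → ℝ) (i : Fin d → Fin M) :
    ∑ k : Freq d M, dft A B ψ k * phase M k.1 (fun a => ((i a : ℕ) : ℤ)) = ψ i := by
  have hM' : (M : ℂ) ^ d ≠ 0 := pow_ne_zero _ (by exact_mod_cast hM.ne')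
  simp only [dft_eq hAB, mul_assoc, Finset.sum_mul, ← Finset.mul_sum]
  rw [Finset.sum_comm]
  have h : ∀ j : Fin d → Fin M, ∑ k : Freq d M, (ψ j : ℂ) *
      (phase M k.1 (-fun a => ((j a : ℕ) : ℤ)) * phase M k.1 (fun a => ((i a : ℕ) : ℤ)))
      = if i = j then (ψ j : ℂ) * (M : ℂ) ^ d else 0 := by
    intro j
    rw [← Finset.mul_sum]
    simp only [phase_comm (M := M) (Subtype.val _), ← phase_add_left]
    simp only [phase_comm (M := M) _ (Subtype.val _)]
    rw [sum_freq_phase hM, add_comm]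
    simp only [vanishes_sub_iff, mul_ite, mul_zero]
  simp only [h, Finset.sum_ite_eq, Finset.mem_univ, if_true]
  field_simp

/-- The quartic term is the mean of the fourth power of the grid function. -/
theorem sum_quartic_eq (hM : 0 < M)
    (hAB : A * Bᵀ = (2 * Real.pi) • (1 : Matrix (Fin d) (Fin d) ℝ))
    (ψ : (Fin d → Fin M) → ℝ) :
    (∑ k₁ : Freq d M, ∑ k₂ : Freq d M, ∑ k₃ : Freq d M, ∑ k₄ : Freq d M,
      if Vanishes M (k₁.1 + k₂.1 + k₃.1 + k₄.1) then
        dft A B ψ k₁ * dft A B ψ k₂ * dft A B ψ k₃ * dft A B ψ k₄ else 0)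
      = ((1 / (M : ℝ) ^ d * ∑ i, ψ i ^ 4 : ℝ) : ℂ) := by
  have hM' : (M : ℂ) ^ d ≠ 0 := pow_ne_zero _ (by exact_mod_cast hM.ne')
  -- The congruence constraint is rewritten as a grid average of characters; the four frequency sums
  -- then factor at each grid point by Fourier inversion.
  have h1 : ∀ (q : Fin d → ℤ) (z : ℂ), (if Vanishes M q then z else 0)
      = ∑ i : Fin d → Fin M, 1 / (M : ℂ) ^ d * (z * phase M q (fun a => ((i a : ℕ) : ℤ))) := by
    intro q z
    rw [← Finset.mul_sum, ← Finset.mul_sum, sum_grid_phase hM]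
    split_ifs
    · field_simp
    · simp
  simp only [h1]
  have h2 : ∀ i, (ψ i : ℂ) ^ 4 = ∑ k₁ : Freq d M, ∑ k₂ : Freq d M, ∑ k₃ : Freq d M,
      ∑ k₄ : Freq d M, dft A B ψ k₁ * dft A B ψ k₂ * dft A B ψ k₃ * dft A B ψ k₄ *
        phase M (k₁.1 + k₂.1 + k₃.1 + k₄.1) (fun a => ((i a : ℕ) : ℤ)) := by
    intro i
    rw [← sum_dft_mul_phase hM hAB ψ i, pow_succ, pow_succ, pow_two]
    simp only [Finset.sum_mul, Finset.mul_sum, phase_add_left]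
    refine Finset.sum_congr rfl fun k₁ _ => Finset.sum_congr rfl fun k₂ _ =>
      Finset.sum_congr rfl fun k₃ _ => Finset.sum_congr rfl fun k₄ _ => ?_
    ring
  push_cast
  simp only [h2, Finset.mul_sum]
  symm
  rw [Finset.sum_comm]
  refine Finset.sum_congr rfl fun k₁ _ => ?_
  rw [Finset.sum_comm]
  refine Finset.sum_congr rfl fun k₂ _ => ?_
  rw [Finset.sum_comm]
  refine Finset.sum_congr rfl fun k₃ _ => ?_
  rw [Finset.sum_comm]

end Orthogonality

/-! ### Smoothness and bounded sublevel sets of the energy. -/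

section Energy

variable {d M : ℕ} {A B : Matrix (Fin d) (Fin d) ℝ}

theorem contDiff_extendZero (k : Freq d M) {n : WithTop ℕ∞} :
    ContDiff ℝ n fun v : coeffSpace d M A B => extendZero v.1.ofLp k := by
  unfold extendZero
  split_ifs with h
  · have h1 : ContDiff ℝ n (fun v : coeffSpace d M A B => (v : EuclideanSpace ℂ (NzFreq d M))) :=
      (coeffSpace d M A B).subtypeL.contDiff
    have h2 : ContDiff ℝ n (fun x : EuclideanSpace ℂ (NzFreq d M) => x.ofLp ⟨k, h⟩) := by
      fun_prop
    exact h2.comp h1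
  · exact contDiff_const

theorem contDiff_reducedEnergy (τ γ : ℝ) {n : WithTop ℕ∞} :
    ContDiff ℝ n (reducedEnergy (d := d) (M := M) A B τ γ) := by
  have hΦ := fun k : Freq d M => contDiff_extendZero (A := A) (B := B) k (n := n)
  have hif : ∀ (P : Prop) [Decidable P] (F : coeffSpace d M A B → ℂ), ContDiff ℝ n F →
      ContDiff ℝ n fun v => if P then F v else 0 := by
    intro P _ F hF
    split_ifs
    exacts [hF, contDiff_const]
  refine Complex.reCLM.contDiff.comp (f := fun v : coeffSpace d M A B =>
    interactionEnergy B (extendZero v.1.ofLp) + bulkEnergy τ γ (extendZero v.1.ofLp)) ?_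
  unfold interactionEnergy bulkEnergy
  refine (contDiff_const.mul (ContDiff.sum fun k₁ _ => ContDiff.sum fun k₂ _ => hif _ _ ?_)).add
    (((contDiff_const.mul (ContDiff.sum fun k₁ _ => ContDiff.sum fun k₂ _ => hif _ _ ?_)).sub
    (contDiff_const.mul (ContDiff.sum fun k₁ _ => ContDiff.sum fun k₂ _ => ContDiff.sum fun k₃ _ =>
      hif _ _ ?_))).add
    (contDiff_const.mul (ContDiff.sum fun k₁ _ => ContDiff.sum fun k₂ _ => ContDiff.sum fun k₃ _ =>
      ContDiff.sum fun k₄ _ => hif _ _ ?_)))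
  · exact contDiff_const.mul ((hΦ k₁).mul (hΦ k₂))
  · exact (hΦ k₁).mul (hΦ k₂)
  · exact ((hΦ k₁).mul (hΦ k₂)).mul (hΦ k₃)
  · exact (((hΦ k₁).mul (hΦ k₂)).mul (hΦ k₃)).mul (hΦ k₄)

theorem norm_ite_le {P : Prop} [Decidable P] {z : ℂ} {c : ℝ} (hz : ‖z‖ ≤ c) :
    ‖if P then z else 0‖ ≤ c := by
  split_ifs
  · exact hz
  · simpa using (norm_nonneg z).trans hz

theorem norm_sum_le_card_mul {ι : Type*} [Fintype ι] {F : ι → ℂ} {c : ℝ}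
    (hF : ∀ k, ‖F k‖ ≤ c) : ‖∑ k, F k‖ ≤ Fintype.card ι * c := by
  refine (norm_sum_le_of_le _ fun k _ => hF k).trans ?_
  simp

/-- All the terms of the energy but the quartic one are of lower order. -/
theorem exists_norm_energy_sub_le (B : Matrix (Fin d) (Fin d) ℝ) (τ γ : ℝ) :
    ∃ C : ℝ, 0 ≤ C ∧ ∀ (Φ : Freq d M → ℂ) (t : ℝ), 0 ≤ t → (∀ k, ‖Φ k‖ ≤ t) →
      ‖interactionEnergy B Φ + bulkEnergy τ γ Φ - 1 / 24 * (∑ k₁ : Freq d M, ∑ k₂ : Freq d M,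
        ∑ k₃ : Freq d M, ∑ k₄ : Freq d M, if Vanishes M (k₁.1 + k₂.1 + k₃.1 + k₄.1) then
          Φ k₁ * Φ k₂ * Φ k₃ * Φ k₄ else 0)‖ ≤ C * (t ^ 2 + t ^ 3) := by
  obtain ⟨D, hD⟩ := (Set.finite_range fun k : Freq d M =>
    ‖(((1 - waveVec B k.1 ⬝ᵥ waveVec B k.1) ^ 2 : ℝ) : ℂ)‖).bddAbove
  have hD' : ∀ k : Freq d M, ‖(((1 - waveVec B k.1 ⬝ᵥ waveVec B k.1) ^ 2 : ℝ) : ℂ)‖ ≤ |D| :=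
    fun k => (hD ⟨k, rfl⟩).trans (le_abs_self D)
  set n : ℝ := ((Fintype.card (Freq d M) : ℕ) : ℝ)
  have hn : 0 ≤ n := Nat.cast_nonneg _
  refine ⟨1 / 2 * (n * (n * |D|)) + |τ| / 2 * (n * n) + |γ| / 6 * (n * (n * n)), by positivity,
    fun Φ t ht hΦ => ?_⟩
  have hΦ2 : ∀ k₁ k₂, ‖Φ k₁ * Φ k₂‖ ≤ t * t := fun k₁ k₂ => by
    rw [norm_mul]; exact mul_le_mul (hΦ _) (hΦ _) (norm_nonneg _) ht
  have hΦ3 : ∀ k₁ k₂ k₃, ‖Φ k₁ * Φ k₂ * Φ k₃‖ ≤ t * t * t := fun k₁ k₂ k₃ => by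
    rw [norm_mul]; exact mul_le_mul (hΦ2 _ _) (hΦ _) (norm_nonneg _) (by positivity)
  have h1 : ‖interactionEnergy B Φ‖ ≤ 1 / 2 * (n * (n * (|D| * (t * t)))) := by
    rw [interactionEnergy, norm_mul]
    refine mul_le_mul (by norm_num) (norm_sum_le_card_mul fun k₁ => norm_sum_le_card_mul fun k₂ =>
      norm_ite_le ?_) (norm_nonneg _) (by norm_num)
    rw [norm_mul]
    exact mul_le_mul (hD' _) (hΦ2 _ _) (norm_nonneg _) (abs_nonneg _)
  have h2 : ‖(τ : ℂ) / 2 * (∑ k₁ : Freq d M, ∑ k₂ : Freq d M,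
      if Vanishes M (k₁.1 + k₂.1) then Φ k₁ * Φ k₂ else 0)‖ ≤ |τ| / 2 * (n * (n * (t * t))) := by
    rw [norm_mul]
    exact mul_le_mul (by simp) (norm_sum_le_card_mul fun k₁ => norm_sum_le_card_mul fun k₂ =>
      norm_ite_le (hΦ2 _ _)) (norm_nonneg _) (by positivity)
  have h3 : ‖(γ : ℂ) / 6 * (∑ k₁ : Freq d M, ∑ k₂ : Freq d M, ∑ k₃ : Freq d M,
      if Vanishes M (k₁.1 + k₂.1 + k₃.1) then Φ k₁ * Φ k₂ * Φ k₃ else 0)‖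
      ≤ |γ| / 6 * (n * (n * (n * (t * t * t)))) := by
    rw [norm_mul]
    exact mul_le_mul (by simp) (norm_sum_le_card_mul fun k₁ => norm_sum_le_card_mul fun k₂ =>
      norm_sum_le_card_mul fun k₃ => norm_ite_le (hΦ3 _ _ _)) (norm_nonneg _) (by positivity)
  rw [bulkEnergy, ← add_assoc, add_sub_cancel_right, ← add_sub_assoc]
  refine (norm_sub_le _ _).trans ((add_le_add ((norm_add_le _ _).trans (add_le_add h1 h2)) h3).trans
    ?_)
  have e1 : 0 ≤ (1 / 2 * (n * (n * |D|)) + |τ| / 2 * (n * n)) * t ^ 3 := by positivity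
  have e2 : 0 ≤ |γ| / 6 * (n * (n * n)) * t ^ 2 := by positivity
  linarith

/-- A coefficient is at most the mean of `|ψ|`, and the power mean inequality applies. -/
theorem norm_dft_pow_four_le (hM : 0 < M)
    (hAB : A * Bᵀ = (2 * Real.pi) • (1 : Matrix (Fin d) (Fin d) ℝ))
    (ψ : (Fin d → Fin M) → ℝ) (k : Freq d M) :
    ‖dft A B ψ k‖ ^ 4 ≤ 1 / (M : ℝ) ^ d * ∑ i, ψ i ^ 4 := by
  have hM' : (0 : ℝ) < (M : ℝ) ^ d := pow_pos (by exact_mod_cast hM) _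
  have h1 : ‖dft A B ψ k‖ ≤ ∑ i, 1 / (M : ℝ) ^ d * |ψ i| := by
    rw [dft_eq hAB, norm_mul, ← Finset.mul_sum]
    refine mul_le_mul (by simp) ((norm_sum_le _ _).trans (le_of_eq ?_)) (norm_nonneg _)
      (by positivity)
    refine Finset.sum_congr rfl fun i _ => ?_
    rw [norm_mul, norm_phase, mul_one, Complex.norm_real, Real.norm_eq_abs]
  have h2 := Real.pow_arith_mean_le_arith_mean_pow Finset.univ (fun _ : Fin d → Fin M =>
    1 / (M : ℝ) ^ d) (fun i => |ψ i|) (fun i _ => by positivity)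
    (by simp [mul_inv_cancel₀ hM'.ne']) (fun i _ => abs_nonneg _) 4
  refine (pow_le_pow_left₀ (norm_nonneg _) h1 4).trans (h2.trans (le_of_eq ?_))
  rw [Finset.mul_sum]
  refine Finset.sum_congr rfl fun i _ => ?_
  rw [Even.pow_abs (by decide)]

/-- The mass-constrained energy has bounded sublevel sets. -/
theorem isBounded_reducedEnergy_le (hM : 0 < M)
    (hAB : A * Bᵀ = (2 * Real.pi) • (1 : Matrix (Fin d) (Fin d) ℝ)) (τ γ a : ℝ) :
    Bornology.IsBounded {v : coeffSpace d M A B | reducedEnergy A B τ γ v ≤ a} := by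
  obtain ⟨C, hC, hbound⟩ := exists_norm_energy_sub_le (M := M) B τ γ
  set m : ℝ := ((Fintype.card (NzFreq d M) : ℕ) : ℝ)
  -- For `t = ‖v‖ > 1` the lower-order terms are at most `2 * C * t ^ 3`, whereas the mean `q` of
  -- `ψ^4` is at least `t ^ 4 / m ^ 2` when `m > 0`; comparing powers of `t` gives this radius.
  refine isBounded_iff_forall_norm_le.2 ⟨max 1 (m ^ 2 * 24 * (|a| + 2 * C)), fun v hv => ?_⟩
  obtain ⟨ψ, hψ⟩ := v.2
  have hnorm : ‖v‖ ^ 2 = ∑ k, ‖v.1.ofLp k‖ ^ 2 :=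
    EuclideanSpace.norm_sq_eq v.1
  have hle : ∀ k, ‖extendZero v.1.ofLp k‖ ≤ ‖v‖ := by
    intro k
    unfold extendZero
    split_ifs
    · exact PiLp.norm_apply_le v.1 _
    · simp
  set q : ℝ := 1 / (M : ℝ) ^ d * ∑ i, ψ i ^ 4
  have hq : ‖v‖ ^ 4 ≤ m ^ 2 * q := by
    have h1 : ∀ k, (‖v.1.ofLp k‖ ^ 2) ^ 2 ≤ q := by
      intro k
      have := norm_dft_pow_four_le hM hAB ψ k.1
      rw [← hψ, extendZero, dif_pos k.2] at this
      rw [← pow_mul]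
      exact this
    calc ‖v‖ ^ 4 = (∑ k, ‖v.1.ofLp k‖ ^ 2) ^ 2 := by rw [← hnorm, ← pow_mul]
      _ ≤ m * ∑ k, (‖v.1.ofLp k‖ ^ 2) ^ 2 := by
        simpa [m] using sq_sum_le_card_mul_sum_sq (s := Finset.univ)
          (f := fun k => ‖v.1.ofLp k‖ ^ 2)
      _ ≤ m * (m * q) := by
        refine mul_le_mul_of_nonneg_left ?_ (Nat.cast_nonneg _)
        refine (Finset.sum_le_sum fun k _ => h1 k).trans (le_of_eq ?_)
        simp [m]
      _ = m ^ 2 * q := by ring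
  have h2 := hbound (extendZero v.1.ofLp) ‖v‖ (norm_nonneg _) hle
  have hfun : extendZero v.1.ofLp = dft A B ψ := funext hψ
  have hquart := sum_quartic_eq hM hAB ψ
  rw [← hfun] at hquart
  rw [hquart] at h2
  have h3 := (abs_le.1 ((Complex.abs_re_le_norm _).trans h2)).1
  rw [Complex.sub_re] at h3
  have h4 : ((1 : ℂ) / 24 * (q : ℂ)).re = q / 24 := by
    rw [show (1 : ℂ) / 24 * (q : ℂ) = ((q / 24 : ℝ) : ℂ) by push_cast; ring, Complex.ofReal_re]
  have h5 : (interactionEnergy B (extendZero v.1.ofLp) + bulkEnergy τ γ (extendZero v.1.ofLp)).re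
      ≤ a := hv
  rw [h4] at h3
  by_contra! hlt
  obtain ⟨hlt1, hlt2⟩ := max_lt_iff.1 hlt
  have h6 : q ≤ 24 * (|a| + C * (‖v‖ ^ 2 + ‖v‖ ^ 3)) := by linarith [le_abs_self a]
  have h7 : ‖v‖ ^ 2 ≤ ‖v‖ ^ 3 := pow_le_pow_right₀ hlt1.le (by norm_num)
  have h8 : 1 ≤ ‖v‖ ^ 3 := one_le_pow₀ hlt1.le
  have h9 : |a| + C * (‖v‖ ^ 2 + ‖v‖ ^ 3) ≤ (|a| + 2 * C) * ‖v‖ ^ 3 := by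
    nlinarith [abs_nonneg a]
  have h10 : ‖v‖ ^ 4 ≤ m ^ 2 * 24 * (|a| + 2 * C) * ‖v‖ ^ 3 := by
    refine hq.trans ?_
    have : q ≤ 24 * ((|a| + 2 * C) * ‖v‖ ^ 3) := by linarith
    calc m ^ 2 * q ≤ m ^ 2 * (24 * ((|a| + 2 * C) * ‖v‖ ^ 3)) :=
          mul_le_mul_of_nonneg_left this (by positivity)
      _ = _ := by ring
  have h11 : m ^ 2 * 24 * (|a| + 2 * C) * ‖v‖ ^ 3 < ‖v‖ * ‖v‖ ^ 3 :=
    mul_lt_mul_of_pos_right hlt2 (by linarith)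
  rw [← pow_succ'] at h11
  exact h11.not_ge h10

end Energy

end LandauBrazovskii

theorem mainTheorem1 (d M : ℕ) (hM : 0 < M) (A B : Matrix (Fin d) (Fin d) ℝ)
    (hAB : A * Bᵀ = (2 * Real.pi) • (1 : Matrix (Fin d) (Fin d) ℝ)) (τ γ : ℝ)
    (p : TrustRegion.Params)
    (v s : ℕ → LandauBrazovskii.coeffSpace d M A B) (lam r ν μ ϱ : ℕ → ℝ)
    (hrun : TrustRegion.IsRun p (LandauBrazovskii.reducedEnergy A B τ γ) v s lam r ν μ ϱ) :
    Tendsto (fun j => ‖gradient (LandauBrazovskii.reducedEnergy A B τ γ) (v j)‖) atTop (𝓝 0) ∧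
    0 ≤ liminf (fun j => TrustRegion.minEigenvalue
      (TrustRegion.hess (LandauBrazovskii.reducedEnergy A B τ γ) (v j))) atTop ∧
    Tendsto (fun j => Metric.infEDist (v j)
      {w | TrustRegion.IsSecondOrderStationary (LandauBrazovskii.reducedEnergy A B τ γ) w})
      atTop (𝓝 0) :=
  hrun.tendsto_stationary (LandauBrazovskii.contDiff_reducedEnergy τ γ)
    (LandauBrazovskii.isBounded_reducedEnergy_le hM hAB τ γ)
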